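/- For $s\in\mathbb{N}=\{1,2,\dots\}$ and $\boldsymbol{k}=(k_1,\dots,k_s)\in\mathbb{N}_0^s$ (with $\mathbb{N}_0=\mathbb{N}\cup\{0\}$), let $\mathrm{wal}_{\boldsymbol{k}}(\boldsymbol{x})=\prod_{j=1}^s\prod_{\ell\in\kappa_j}(-1)^{x_{j,\ell}}$ for $\boldsymbol{x}\in[0,1)^s$ be the base-2 Walsh function, where $\kappa_j=\{\ell\in\mathbb{N}: a_\ell=1\}$ for the binary expansion $k_j=\sum_{\ell\ge1}a_\ell2^{\ell-1}$ and $x_j=\sum_{\ell\ge1}x_{j,\ell}2^{-\ell}$ is the binary expansion of $x_j$ (the finite one, if there are two). Let $\hat f(\boldsymbol{k})=\int_{[0,1]^s}f(\boldsymbol{x})\,\mathrm{wal}_{\boldsymbol{k}}(\boldsymbol{x})\,d\boldsymbol{x}$. For $q\in\mathbb{N}$ let $\lceil\boldsymbol{k}\rceil_q\in\mathbb{N}_0^s$ be the vector whose $j$-th component is the $q$-th largest element of $\kappa_j$, or $0$ if $|\kappa_j|<q$. For $0<\lambda\le1$ and a real function $g$ on $[0,1]^s$, the fractional Vitali variation of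 order $\lambda$ is $$V_\lambda^{(s)}(g)=\sup_{\mathcal P}\Bigl(\sum_{J\in\mathcal P}\mathrm{Vol}(J)\Bigl|\frac{\Delta(g,J)}{\mathrm{Vol}(J)^\lambda}\Bigr|^2\Bigr)^{1/2}\in[0,\infty],$$ where $\mathcal P$ runs over the finite partitions of $[0,1)^s$ into boxes $J=\prod_{j=1}^s[d_j,e_j)$ with $d_j<e_j$, and $\Delta(g,J)=\sum_{u\subseteq\{1,\dots,s\}}(-1)^{s-|u|}g(\boldsymbol{d}_u,\boldsymbol{e}_{u^c})$ is the alternating sum of $g$ over the vertices of $J$; here $(\boldsymbol{d}_u,\boldsymbol{e}_{u^c})$ has $j$-th coordinate $d_j$ if $j\in u$ and $e_j$ if $j\notin u$. **Theorem.** Let $s\in\mathbb{N}$, $\alpha\in\mathbb{N}_0$ and $0<\lambda\le1$. Let $f:[0,1]^s\to\mathbb{R}$ be continuous, and suppose that the mixed derivative $$f^{(\alpha,\dots,\alpha)}=\frac{\partial^{s\alpha}f}{\partial x_1^\alpha\cdots\partial x_s^\alpha}$$ (partial derivatives being one-sided at the boundary; $f^{(0,\dots,0)}=f$) exists and is continuous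 on $[0,1]^s$ and that $V^{(s)}_\lambda(f^{(\alpha,\dots,\alpha)})<\infty$. For $\boldsymbol{\ell}=(\ell_1,\dots,\ell_s)\in\mathbb{N}^s$ put $\|\boldsymbol{\ell}\|_1=\sum_{j=1}^s\ell_j$ and $$B_{\alpha,\boldsymbol{\ell},s}=\{\boldsymbol{k}\in\mathbb{N}_0^s\setminus\{\boldsymbol{0}\}:\lceil\boldsymbol{k}\rceil_{\alpha+1}=\boldsymbol{\ell}\}.$$ Then $$\Bigl(\sum_{\boldsymbol{k}\in B_{\alpha,\boldsymbol{\ell},s}}|\hat f(\boldsymbol{k})|^2\Bigr)^{1/2}\le V^{(s)}_\lambda(f^{(\alpha,\dots,\alpha)})\,2^{-(\alpha+\lambda)\|\boldsymbol{\ell}\|_1};$$ in particular the sum converges. -/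

import Mathlib

noncomputable section

namespace WalshDecay

/-- The closed unit cube `[0,1]^s`. -/
def cube (s : ℕ) : Set (Fin s → ℝ) := Set.univ.pi fun _ => Set.Icc (0 : ℝ) 1

/-! ### Walsh functions and Walsh coefficients in base 2 -/

/-- The set `κ` of positions `ℓ ≥ 1` of the nonzero bits of `k = ∑ a_ℓ 2^(ℓ-1)`. -/
def nonzeroBits (k : ℕ) : Finset ℕ := {l ∈ Finset.Icc 1 k.size | k.testBit (l - 1) = true}

theorem mem_nonzeroBits (k l : ℕ) :
    l ∈ nonzeroBits k ↔ 1 ≤ l ∧ k.testBit (l - 1) = true := by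
  simp only [nonzeroBits, Finset.mem_filter, Finset.mem_Icc]
  constructor
  · rintro ⟨⟨h, -⟩, h'⟩
    exact ⟨h, h'⟩
  · rintro ⟨h, h'⟩
    refine ⟨⟨h, ?_⟩, h'⟩
    have h1 : l - 1 < k.size := Nat.lt_size.2 (Nat.ge_two_pow_of_testBit h')
    omega

/-- The `q`-th largest element of `κ` (for `q ≥ 1`), equal to `0` if `κ` has fewer than `q`
elements. -/
def nthLargest (κ : Finset ℕ) (q : ℕ) : ℕ := (κ.sort (fun a b => b ≤ a)).getD (q - 1) 0

/-- The `l`-th digit (`l ≥ 1`) of `x ∈ [0,1)` in base 2, for the expansion that is not eventually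
equal to `1`. -/
def binaryDigit (x : ℝ) (l : ℕ) : ℕ := ⌊(2 : ℝ) ^ l * x⌋₊ % 2

/-- The univariate Walsh function `wal_k`. -/
def walsh (k : ℕ) (x : ℝ) : ℝ := (-1) ^ (∑ l ∈ nonzeroBits k, binaryDigit x l)

/-- The Walsh coefficient of `f` at `k`. The Walsh functions are of interest on `[0,1)^s`; their
values on the faces `x j = 1`, which form a null set, play no role. -/
def walshCoeff {s : ℕ} (f : (Fin s → ℝ) → ℝ) (k : Fin s → ℕ) : ℝ :=
  ∫ x in cube s, f x * ∏ j, walsh (k j) (x j)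

/-- The nonzero frequency vectors `k` for which, for every `j`, the `q`-th largest position of a
nonzero bit of `k j` is `ℓ j`. -/
def bitClass {s : ℕ} (q : ℕ) (ℓ : Fin s → ℕ) : Set (Fin s → ℕ) :=
  {k | k ≠ 0 ∧ ∀ j, nthLargest (nonzeroBits (k j)) q = ℓ j}

/-! ### Mixed partial derivatives on the closed cube -/

/-- The partial derivative in the variable `x j` on the closed cube, one-sided on the faces. -/
def partialDeriv {s : ℕ} (j : Fin s) (f : (Fin s → ℝ) → ℝ) : (Fin s → ℝ) → ℝ := fun x =>
  derivWithin (fun t => f (Function.update x j t)) (Set.Icc 0 1) (x j)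

/-- The partial derivative in the variable `x j` exists at every point of the closed cube. -/
def HasPartialDeriv {s : ℕ} (j : Fin s) (f : (Fin s → ℝ) → ℝ) : Prop :=
  ∀ x ∈ cube s,
    DifferentiableWithinAt ℝ (fun t => f (Function.update x j t)) (Set.Icc 0 1) (x j)

/-- `∂_{j_1} ∂_{j_2} ⋯ ∂_{j_r} f` for the list `[j_1, …, j_r]`. -/
def iterPartial {s : ℕ} : List (Fin s) → ((Fin s → ℝ) → ℝ) → (Fin s → ℝ) → ℝ
  | [], f => f
  | j :: L, f => partialDeriv j (iterPartial L f)

/-- All the partial derivatives taken in forming `∂_{j_1} ∂_{j_2} ⋯ ∂_{j_r} f` exist. -/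
def HasIterPartial {s : ℕ} : List (Fin s) → ((Fin s → ℝ) → ℝ) → Prop
  | [], _ => True
  | j :: L, f => HasIterPartial L f ∧ HasPartialDeriv j (iterPartial L f)

/-- The list `[1, …, 1, 2, …, 2, …, s, …, s]` in which `j` occurs `β j` times. -/
def multiIndexList {s : ℕ} (β : Fin s → ℕ) : List (Fin s) :=
  (List.finRange s).flatMap fun j => List.replicate (β j) j

/-- `f^(β) = ∂^|β| f / ∂x_1^{β_1} ⋯ ∂x_s^{β_s}`. -/
def mixedDeriv {s : ℕ} (β : Fin s → ℕ) (f : (Fin s → ℝ) → ℝ) : (Fin s → ℝ) → ℝ :=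
  iterPartial (multiIndexList β) f

/-- `f^(β)` exists on the closed cube. -/
def HasMixedDeriv {s : ℕ} (β : Fin s → ℕ) (f : (Fin s → ℝ) → ℝ) : Prop :=
  HasIterPartial (multiIndexList β) f

/-! ### Fractional Vitali variation -/

/-- The half-open box `∏ [a_j, b_j)`. -/
def halfOpenBox {s : ℕ} (a b : Fin s → ℝ) : Set (Fin s → ℝ) :=
  Set.univ.pi fun j => Set.Ico (a j) (b j)

/-- The volume of `∏ [a_j, b_j)`, where `a_j ≤ b_j`. -/
def boxVol {s : ℕ} (a b : Fin s → ℝ) : ℝ := ∏ j, (b j - a j)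

theorem boxVol_eq_volume {s : ℕ} (a b : Fin s → ℝ) (h : a ≤ b) :
    boxVol a b = (MeasureTheory.volume (halfOpenBox a b)).toReal := by
  rw [halfOpenBox, Real.volume_pi_Ico_toReal h, boxVol]

/-- The alternating sum `∑_u (-1)^(s-|u|) f(a_u, b_{u^c})` of `f` over the vertices of
`∏ [a_j, b_j)`. -/
def altSum {s : ℕ} (f : (Fin s → ℝ) → ℝ) (a b : Fin s → ℝ) : ℝ :=
  ∑ u : Finset (Fin s), (-1) ^ (s - u.card) * f (fun j => if j ∈ u then a j else b j)

/-- `P` is a finite partition of `[0,1)^s` into nonempty boxes `∏ [a_j, b_j)`, each of them given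
by the pair `(a, b)`. -/
structure IsBoxPartition {s : ℕ} (P : Finset ((Fin s → ℝ) × (Fin s → ℝ))) : Prop where
  lt : ∀ J ∈ P, ∀ j, J.1 j < J.2 j
  disjoint : ∀ J ∈ P, ∀ K ∈ P, J ≠ K → Disjoint (halfOpenBox J.1 J.2) (halfOpenBox K.1 K.2)
  cover : ⋃ J ∈ P, halfOpenBox J.1 J.2 = halfOpenBox (0 : Fin s → ℝ) 1

/-- The sum `∑_{J ∈ P} Vol(J) |Δ(f,J) / Vol(J)^λ|^2`. -/
def vitaliSum {s : ℕ} (lam : ℝ) (f : (Fin s → ℝ) → ℝ)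
    (P : Finset ((Fin s → ℝ) × (Fin s → ℝ))) : ℝ :=
  ∑ J ∈ P, boxVol J.1 J.2 * |altSum f J.1 J.2 / boxVol J.1 J.2 ^ lam| ^ 2

/-- The fractional Vitali variation of order `λ`, a number in `[0,∞]`. -/
def vitaliVar {s : ℕ} (lam : ℝ) (f : (Fin s → ℝ) → ℝ) : ENNReal :=
  ⨆ (P : Finset ((Fin s → ℝ) × (Fin s → ℝ))) (_ : IsBoxPartition P),
    ENNReal.ofReal (Real.sqrt (vitaliSum lam f P))

end WalshDecay

end

/-!
Decay of Walsh coefficients on a class of frequencies, by finite differences.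

A frequency `k` in the class has, in every coordinate `j`, the bit `ℓ j`, exactly `α` larger bits
forming a set `P j`, and an arbitrary set of bits below `ℓ j`. For fixed `P` the lower bits are
handled by Parseval's identity: the Walsh functions of the lower bits are constant on the dyadic
cells of side lengths `2 ^ (-(ℓ j - 1))` and form an orthogonal system there (`parseval_cells`), so
the sum over them is a multiple of the sum of the squares of the cell integrals of `f` against the
Rademacher functions of the bits `ℓ j` and `P j`.

In such a cell integral each Rademacher factor is turned into a difference operator with step
`2 ^ (-p)`, restricting the integral to the points whose digit `p` is `0`
(`setIntegral_mul_prod_rademacher`). The mean value inequality trades the `α` differences with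
steps `2 ^ (-p)`, `p ∈ P j`, for `α` derivatives in `x j` and the factors `2 ^ (-p)`
(`abs_iterDiff_union_le`). Since it is applied to one variable at a time, nothing beyond the
existence of the intermediate derivatives is needed. The remaining differences, with step
`2 ^ (-ℓ j)` in each variable, form the alternating sum of `f^(α,…,α)` over a box contained in the
cell. As the cells are disjoint, choosing in each cell the box with the largest alternating sum
gives a family of disjoint boxes of equal volume, which extends to a partition of the cube, and the
variation bounds the sum over the cells (`exists_cell_bounds`).

Finally the squares of the factors `2 ^ (-p)` are summed over all `P`
(`sum_powersetCard_prod_inv_le`). This gives `4 ^ (-α ℓ j)` up to a factor `2` in each variable,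
which the factor `1 / 2` left over from Parseval's identity and the volumes compensates.
-/

namespace WalshDecay

/-! ### Binary digits and Rademacher functions -/

/-- The `l`-th Rademacher function, the Walsh function of the single bit `l`. -/
noncomputable def rademacher (l : ℕ) (x : ℝ) : ℝ := (-1) ^ binaryDigit x l

theorem walsh_eq_prod_rademacher (k : ℕ) (x : ℝ) :
    walsh k x = ∏ l ∈ nonzeroBits k, rademacher l x := by
  simp only [walsh, rademacher, Finset.prod_pow_eq_pow_sum]

theorem floor_two_pow_mul {q p : ℕ} (hqp : q ≤ p) (x : ℝ) :
    ⌊(2 : ℝ) ^ q * x⌋₊ = ⌊(2 : ℝ) ^ p * x⌋₊ / 2 ^ (p - q) := by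
  rw [← Nat.floor_div_natCast]
  congr 1
  obtain ⟨d, rfl⟩ := Nat.exists_eq_add_of_le hqp
  simp only [Nat.add_sub_cancel_left, pow_add]
  push_cast
  field_simp

theorem floor_two_pow_mul_add_self {x : ℝ} (hx : 0 ≤ x) (p : ℕ) :
    ⌊(2 : ℝ) ^ p * (x + (2 ^ p)⁻¹)⌋₊ = ⌊(2 : ℝ) ^ p * x⌋₊ + 1 := by
  rw [mul_add, mul_inv_cancel₀ (by positivity), Nat.floor_add_one (by positivity)]

/-- Raising the digit `p` from `0` to `1` does not move the point across a dyadic grid coarser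
than `2 ^ (-p)`. -/
theorem floor_two_pow_mul_add_of_lt {x : ℝ} (hx : 0 ≤ x) {p q : ℕ} (h : binaryDigit x p = 0)
    (hqp : q < p) : ⌊(2 : ℝ) ^ q * (x + (2 ^ p)⁻¹)⌋₊ = ⌊(2 : ℝ) ^ q * x⌋₊ := by
  rw [floor_two_pow_mul hqp.le, floor_two_pow_mul hqp.le, floor_two_pow_mul_add_self hx]
  have h2 : (2 : ℕ) ^ (p - q) = 2 * 2 ^ (p - q - 1) := by
    rw [← pow_succ']; congr 1; omega
  rw [h2, ← Nat.div_div_eq_div_mul, ← Nat.div_div_eq_div_mul]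
  congr 1
  unfold binaryDigit at h
  omega

theorem binaryDigit_add_self {x : ℝ} (hx : 0 ≤ x) {p : ℕ} (h : binaryDigit x p = 0) :
    binaryDigit (x + (2 ^ p)⁻¹) p = 1 := by
  unfold binaryDigit at *
  rw [floor_two_pow_mul_add_self hx]
  omega

theorem binaryDigit_add_of_ne {x : ℝ} (hx : 0 ≤ x) {p q : ℕ} (h : binaryDigit x p = 0)
    (hqp : q ≠ p) : binaryDigit (x + (2 ^ p)⁻¹) q = binaryDigit x q := by
  rcases lt_or_gt_of_ne hqp with hlt | hlt
  · rw [binaryDigit, floor_two_pow_mul_add_of_lt hx h hlt, binaryDigit]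
  · have h2 : (2 : ℝ) ^ q * (2 ^ p)⁻¹ = ((2 * 2 ^ (q - p - 1) : ℕ) : ℝ) := by
      rw [← pow_succ', show q - p - 1 + 1 = q - p by omega]
      push_cast
      rw [pow_sub₀ _ (by norm_num) hlt.le]
    rw [binaryDigit, mul_add, h2, Nat.floor_add_natCast (by positivity), binaryDigit]
    omega

/-- A point whose digit `p` is `1` arises from a point with digit `0` by adding `2 ^ (-p)`. -/
theorem sub_of_binaryDigit_eq_one {x : ℝ} {p : ℕ} (h : binaryDigit x p = 1) :
    0 ≤ x - (2 ^ p)⁻¹ ∧ binaryDigit (x - (2 ^ p)⁻¹) p = 0 := by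
  have h1 : 1 ≤ ⌊(2 : ℝ) ^ p * x⌋₊ := by
    by_contra h0
    simp [binaryDigit, show ⌊(2 : ℝ) ^ p * x⌋₊ = 0 by omega] at h
  have h2 : (1 : ℝ) ≤ 2 ^ p * x := by simpa using (Nat.le_floor_iff' one_ne_zero).1 h1
  have h0 : 0 ≤ x - (2 ^ p)⁻¹ := by
    rw [sub_nonneg, inv_le_iff_one_le_mul₀' (by positivity)]
    exact h2
  refine ⟨h0, ?_⟩
  have h3 := floor_two_pow_mul_add_self h0 p
  rw [sub_add_cancel] at h3
  unfold binaryDigit at *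
  omega

theorem binaryDigit_eq_zero_or_one (x : ℝ) (l : ℕ) : binaryDigit x l = 0 ∨ binaryDigit x l = 1 :=
  Nat.mod_two_eq_zero_or_one _

theorem measurable_binaryDigit (l : ℕ) : Measurable fun x : ℝ => binaryDigit x l :=
  (measurable_from_nat (f := fun n => n % 2)).comp
    (Nat.measurable_floor.comp (measurable_const.mul measurable_id))

theorem measurable_rademacher (l : ℕ) : Measurable (rademacher l) :=
  (measurable_from_nat (f := fun n => (-1 : ℝ) ^ n)).comp (measurable_binaryDigit l)

theorem abs_rademacher (l : ℕ) (x : ℝ) : |rademacher l x| = 1 := by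
  simp [rademacher]

/-! ### Iterated differences -/

/-- The translation of the variable `x j` by `2 ^ (-p)`, for `t = (j, p)`. -/
noncomputable def dyadicShift {s : ℕ} (t : Fin s × ℕ) : Fin s → ℝ := Pi.single t.1 ((2 ^ t.2)⁻¹)

theorem dyadicShift_nonneg {s : ℕ} (t : Fin s × ℕ) : 0 ≤ dyadicShift t := by
  rw [dyadicShift, Pi.single_nonneg]
  positivity

/-- The iterated difference `∏_{t ∈ T} (1 - τ_t) f`, where `τ_t` translates by
`dyadicShift t`. -/
noncomputable def iterDiff {s : ℕ} (T : Finset (Fin s × ℕ)) (f : (Fin s → ℝ) → ℝ)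
    (x : Fin s → ℝ) : ℝ :=
  ∑ u ∈ T.powerset, (-1) ^ u.card * f (x + ∑ t ∈ u, dyadicShift t)

variable {s : ℕ}

@[simp] theorem iterDiff_empty (f : (Fin s → ℝ) → ℝ) : iterDiff ∅ f = f := by
  funext x; simp [iterDiff]

theorem iterDiff_insert {T : Finset (Fin s × ℕ)} {t : Fin s × ℕ} (ht : t ∉ T)
    (f : (Fin s → ℝ) → ℝ) (x : Fin s → ℝ) :
    iterDiff (insert t T) f x = iterDiff T f x - iterDiff T f (x + dyadicShift t) := by
  rw [iterDiff, Finset.sum_powerset_insert ht, sub_eq_add_neg, iterDiff, iterDiff,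
    ← Finset.sum_neg_distrib]
  congr 1
  refine Finset.sum_congr rfl fun u hu => ?_
  have htu : t ∉ u := fun h => ht (Finset.mem_powerset.1 hu h)
  rw [Finset.card_insert_of_notMem htu, Finset.sum_insert htu, add_assoc, pow_succ]
  ring

theorem iterDiff_insert' {T : Finset (Fin s × ℕ)} {t : Fin s × ℕ} (ht : t ∉ T)
    (f : (Fin s → ℝ) → ℝ) :
    iterDiff (insert t T) f = iterDiff T fun x => f x - f (x + dyadicShift t) := by
  funext x
  rw [iterDiff_insert ht]
  simp only [iterDiff, ← Finset.sum_sub_distrib, mul_sub]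
  refine Finset.sum_congr rfl fun u _ => ?_
  rw [add_right_comm]

/-- The difference with step `2 ^ (-ℓ j)` in every variable is the alternating sum over the
vertices of a box. -/
theorem iterDiff_graph_eq_altSum (ℓ : Fin s → ℕ) (f : (Fin s → ℝ) → ℝ) (x : Fin s → ℝ) :
    iterDiff (Finset.univ.image fun j => (j, ℓ j)) f x =
      altSum f x (fun j => x j + (2 ^ ℓ j)⁻¹) := by
  have hinj : Function.Injective fun j : Fin s => (j, ℓ j) := fun a b h => (Prod.ext_iff.1 h).1
  rw [iterDiff, altSum, Finset.powerset_image, Finset.sum_image]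
  · rw [Finset.powerset_univ, ← (compl_bijective (α := Finset (Fin s))).sum_comp]
    refine Finset.sum_congr rfl fun u _ => ?_
    rw [Finset.card_image_of_injective _ hinj, Finset.card_compl,
      Fintype.card_fin, Finset.sum_image hinj.injOn]
    congr 2
    funext j
    simp only [Pi.add_apply, Finset.sum_apply, dyadicShift, Pi.single_apply]
    simp [Finset.sum_ite_eq]
    by_cases hj : j ∈ u <;> simp [hj]
  · exact (Finset.image_injective hinj).injOn

/-! ### Removing Rademacher factors from an integral -/

theorem add_dyadicShift_apply (x : Fin s → ℝ) (t : Fin s × ℕ) :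
    (x + dyadicShift t) t.1 = x t.1 + (2 ^ t.2)⁻¹ := by
  simp [dyadicShift]

theorem add_dyadicShift_apply_of_ne (x : Fin s → ℝ) (t : Fin s × ℕ) {i : Fin s} (h : i ≠ t.1) :
    (x + dyadicShift t) i = x i := by
  simp [dyadicShift, h]

theorem binaryDigit_add_dyadicShift_of_ne {x : Fin s → ℝ} (hx : 0 ≤ x) {t u : Fin s × ℕ}
    (h : binaryDigit (x t.1) t.2 = 0) (hut : u ≠ t) :
    binaryDigit ((x + dyadicShift t) u.1) u.2 = binaryDigit (x u.1) u.2 := by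
  by_cases h1 : u.1 = t.1
  · have h2 : u.2 ≠ t.2 := fun h2 => hut (Prod.ext h1 h2)
    rw [h1, add_dyadicShift_apply, binaryDigit_add_of_ne (hx t.1) h h2]
  · rw [add_dyadicShift_apply_of_ne x t h1]

/-- `Q` is invariant under flipping the digits of its points at the positions in `T`. -/
def FlipInvariant (T : Finset (Fin s × ℕ)) (Q : Set (Fin s → ℝ)) : Prop :=
  ∀ t ∈ T, ∀ x, 0 ≤ x → binaryDigit (x t.1) t.2 = 0 → (x ∈ Q ↔ x + dyadicShift t ∈ Q)

/-- The points whose digits at all the positions in `T` are `0`. -/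
def zeroDigits (T : Finset (Fin s × ℕ)) : Set (Fin s → ℝ) :=
  {x | ∀ t ∈ T, binaryDigit (x t.1) t.2 = 0}

theorem measurableSet_zeroDigits (T : Finset (Fin s × ℕ)) : MeasurableSet (zeroDigits T) := by
  have h : zeroDigits T = ⋂ t ∈ T, (fun x : Fin s → ℝ => binaryDigit (x t.1) t.2) ⁻¹' {0} := by
    ext x; simp [zeroDigits]
  rw [h]
  exact Finset.measurableSet_biInter _ fun t _ =>
    ((measurable_binaryDigit t.2).comp (measurable_pi_apply t.1)) (MeasurableSet.singleton 0)

theorem FlipInvariant.mono {T U : Finset (Fin s × ℕ)} {Q : Set (Fin s → ℝ)}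
    (h : FlipInvariant T Q) (hU : U ⊆ T) : FlipInvariant U Q := fun t ht => h t (hU ht)

theorem FlipInvariant.inter_zeroDigits {T U : Finset (Fin s × ℕ)} {Q : Set (Fin s → ℝ)}
    (h : FlipInvariant T Q) (hTU : Disjoint T U) : FlipInvariant T (Q ∩ zeroDigits U) := by
  intro t ht x hx hd
  refine and_congr (h t ht x hx hd) (forall₂_congr fun u hu => ?_)
  rw [binaryDigit_add_dyadicShift_of_ne hx hd]
  rintro rfl
  exact Finset.disjoint_left.1 hTU ht hu

/-- Raising several digits from `0` to `1` at once stays in a flip-invariant set. -/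
theorem FlipInvariant.add_sum_mem {T : Finset (Fin s × ℕ)} {Q : Set (Fin s → ℝ)}
    (h : FlipInvariant T Q) {x : Fin s → ℝ} (hx : 0 ≤ x) (hxQ : x ∈ Q) (hxT : x ∈ zeroDigits T) :
    x + ∑ t ∈ T, dyadicShift t ∈ Q := by
  induction T using Finset.induction_on generalizing x with
  | empty => simpa using hxQ
  | insert t T ht ih =>
    have hd : binaryDigit (x t.1) t.2 = 0 := hxT t (Finset.mem_insert_self t T)
    rw [Finset.sum_insert ht, ← add_assoc]
    refine ih (h.mono (Finset.subset_insert t T)) (add_nonneg hx (dyadicShift_nonneg t))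
      ((h t (Finset.mem_insert_self t T) x hx hd).1 hxQ) fun u hu => ?_
    rw [binaryDigit_add_dyadicShift_of_ne hx hd (fun hut => ht (hut ▸ hu))]
    exact hxT u (Finset.mem_insert_of_mem hu)

open MeasureTheory

theorem measurable_prod_rademacher (T : Finset (Fin s × ℕ)) :
    Measurable fun x : Fin s → ℝ => ∏ t ∈ T, rademacher t.2 (x t.1) :=
  Finset.measurable_prod _ fun t _ =>
    (measurable_rademacher t.2).comp (measurable_pi_apply t.1)

theorem integrableOn_mul_prod_rademacher {f : (Fin s → ℝ) → ℝ} {Q : Set (Fin s → ℝ)}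
    (hf : IntegrableOn f Q) (T : Finset (Fin s × ℕ)) :
    IntegrableOn (fun x => f x * ∏ t ∈ T, rademacher t.2 (x t.1)) Q := by
  refine Integrable.mul_bdd (c := 1) hf (measurable_prod_rademacher T).aestronglyMeasurable ?_
  filter_upwards with x
  rw [Real.norm_eq_abs, Finset.abs_prod]
  exact (Finset.prod_eq_one fun t _ => abs_rademacher _ _).le

theorem preimage_add_dyadicShift {Q : Set (Fin s → ℝ)} {t : Fin s × ℕ}
    (hQ0 : ∀ x ∈ Q, 0 ≤ x) (hQ : FlipInvariant {t} Q) :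
    (fun x => x + dyadicShift t) ⁻¹' (Q \ zeroDigits {t}) = Q ∩ zeroDigits {t} := by
  ext x
  simp only [Set.mem_preimage, Set.mem_sdiff, zeroDigits, Set.mem_ofPred_eq, Finset.mem_singleton,
    forall_eq, Set.mem_inter_iff]
  constructor
  · rintro ⟨h1, h2⟩
    have h3 := sub_of_binaryDigit_eq_one ((binaryDigit_eq_zero_or_one _ _).resolve_left h2)
    rw [add_dyadicShift_apply, add_sub_cancel_right] at h3
    have hx : 0 ≤ x := by
      intro i
      by_cases hi : i = t.1
      · rw [hi]; exact h3.1
      · have := hQ0 _ h1 i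
        rwa [add_dyadicShift_apply_of_ne x t hi] at this
    exact ⟨(hQ t (Finset.mem_singleton_self t) x hx h3.2).2 h1, h3.2⟩
  · rintro ⟨h1, h2⟩
    refine ⟨(hQ t (Finset.mem_singleton_self t) x (hQ0 x h1) h2).1 h1, ?_⟩
    rw [add_dyadicShift_apply, binaryDigit_add_self (hQ0 x h1 t.1) h2]
    exact one_ne_zero

/-- Each Rademacher factor turns into a difference operator: the two halves of `Q` on which it is
`1` and `-1` are translates of each other. -/
theorem setIntegral_mul_prod_rademacher (T : Finset (Fin s × ℕ)) {f : (Fin s → ℝ) → ℝ}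
    {Q : Set (Fin s → ℝ)} (hQm : MeasurableSet Q) (hQ0 : ∀ x ∈ Q, 0 ≤ x)
    (hQ : FlipInvariant T Q) (hf : IntegrableOn f Q) :
    ∫ x in Q, f x * ∏ t ∈ T, rademacher t.2 (x t.1) =
      ∫ x in Q ∩ zeroDigits T, iterDiff T f x := by
  induction T using Finset.induction_on generalizing f Q with
  | empty => simp [zeroDigits]
  | insert t T ht ih =>
    have hZm := measurableSet_zeroDigits (s := s) {t}
    have hQt : FlipInvariant {t} Q := hQ.mono (by simp)
    have hpre := preimage_add_dyadicShift hQ0 hQt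
    have hmp := measurePreserving_add_right (volume : Measure (Fin s → ℝ)) (dyadicShift t)
    have hemb := measurableEmbedding_addRight (dyadicShift t)
    have hfZ : IntegrableOn f (Q ∩ zeroDigits {t}) := hf.mono_set Set.inter_subset_left
    have hfO : IntegrableOn f (Q \ zeroDigits {t}) := hf.mono_set Set.sdiff_subset
    have hfshift : IntegrableOn (fun x => f (x + dyadicShift t)) (Q ∩ zeroDigits {t}) := by
      rw [← hpre]
      exact (hmp.integrableOn_comp_preimage hemb).2 hfO
    have hprod : ∀ x ∈ Q ∩ zeroDigits {t},
        ∏ u ∈ T, rademacher u.2 ((x + dyadicShift t) u.1) =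
          ∏ u ∈ T, rademacher u.2 (x u.1) := by
      rintro x ⟨hx, hxt⟩
      refine Finset.prod_congr rfl fun u hu => ?_
      rw [rademacher, binaryDigit_add_dyadicShift_of_ne (hQ0 x hx)
        (hxt t (Finset.mem_singleton_self t)) (fun hut => ht (hut ▸ hu)), rademacher]
    rw [← integral_inter_add_sdiff hZm (integrableOn_mul_prod_rademacher hf _)]
    have h1 : ∫ x in Q ∩ zeroDigits {t}, f x * ∏ u ∈ insert t T, rademacher u.2 (x u.1) =
        ∫ x in Q ∩ zeroDigits {t}, f x * ∏ u ∈ T, rademacher u.2 (x u.1) := by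
      refine setIntegral_congr_fun (hQm.inter hZm) fun x hx => ?_
      have h0 : binaryDigit (x t.1) t.2 = 0 := hx.2 t (Finset.mem_singleton_self t)
      simp [Finset.prod_insert ht, rademacher, h0]
    have h2 : ∫ x in Q \ zeroDigits {t}, f x * ∏ u ∈ insert t T, rademacher u.2 (x u.1) =
        -∫ x in Q ∩ zeroDigits {t},
          f (x + dyadicShift t) * ∏ u ∈ T, rademacher u.2 (x u.1) := by
      have h3 : ∫ x in Q \ zeroDigits {t}, f x * ∏ u ∈ insert t T, rademacher u.2 (x u.1) =
          ∫ x in Q \ zeroDigits {t}, -(f x * ∏ u ∈ T, rademacher u.2 (x u.1)) := by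
        refine setIntegral_congr_fun (hQm.diff hZm) fun x hx => ?_
        have h0 : binaryDigit (x t.1) t.2 = 1 :=
          (binaryDigit_eq_zero_or_one _ _).resolve_left fun h => hx.2 (by
            simpa [zeroDigits] using h)
        simp [Finset.prod_insert ht, rademacher, h0]
      rw [h3, integral_neg, ← hmp.setIntegral_preimage_emb hemb, hpre]
      congr 1
      refine setIntegral_congr_fun (hQm.inter hZm) fun x hx => ?_
      simp only [hprod x hx]
    rw [h1, h2, ← sub_eq_add_neg, ← integral_sub (integrableOn_mul_prod_rademacher hfZ T)
      (integrableOn_mul_prod_rademacher hfshift T)]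
    simp only [← sub_mul]
    rw [ih (f := fun x => f x - f (x + dyadicShift t)) (hQm.inter hZm) (fun x hx => hQ0 x hx.1)
      ((hQ.mono (Finset.subset_insert t T)).inter_zeroDigits
        (Finset.disjoint_singleton_right.2 ht)) (hfZ.sub hfshift), iterDiff_insert' ht]
    congr 2
    ext x
    simp [zeroDigits, and_assoc]

/-! ### Differences and derivatives -/

theorem hasDerivWithinAt_iterDiff {j : Fin s} {f : (Fin s → ℝ) → ℝ} (hf : HasPartialDeriv j f)
    (T : Finset (Fin s × ℕ)) {x : Fin s → ℝ} {h τ : ℝ} (hx : 0 ≤ x)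
    (hx1 : x + Pi.single j h + ∑ t ∈ T, dyadicShift t ≤ 1) (hτ : τ ∈ Set.Icc 0 h) :
    HasDerivWithinAt (fun r => iterDiff T f (x + Pi.single j r))
      (iterDiff T (partialDeriv j f) (x + Pi.single j τ)) (Set.Icc 0 h) τ := by
  unfold iterDiff
  refine HasDerivWithinAt.fun_sum fun u hu => HasDerivWithinAt.const_mul _ ?_
  have hu0 : 0 ≤ ∑ t ∈ u, dyadicShift t := Finset.sum_nonneg fun t _ => dyadicShift_nonneg t
  have huT : ∑ t ∈ u, dyadicShift t ≤ ∑ t ∈ T, dyadicShift t :=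
    Finset.sum_le_sum_of_subset_of_nonneg (Finset.mem_powerset.1 hu)
      fun t _ _ => dyadicShift_nonneg t
  have hmem : ∀ r ∈ Set.Icc 0 h, x + Pi.single j r + ∑ t ∈ u, dyadicShift t ∈ cube s := by
    intro r hr i _
    have h1 := hx i
    have h2 := hx1 i
    have h3 := hu0 i
    have h4 := huT i
    have h5 : (0 : Fin s → ℝ) ≤ Pi.single j r := Pi.single_nonneg.2 hr.1
    have h6 : (Pi.single j r : Fin s → ℝ) ≤ Pi.single j h := Pi.single_le_single.2 hr.2
    replace h5 := h5 i
    replace h6 := h6 i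
    simp only [Pi.add_apply, Pi.zero_apply, Pi.one_apply] at *
    constructor <;> linarith
  set z := x + Pi.single j τ + ∑ t ∈ u, dyadicShift t with hz
  have hd := (hf z (hmem τ hτ)).hasDerivWithinAt
  have hshift : ∀ r, x + Pi.single j r + ∑ t ∈ u, dyadicShift t =
      Function.update z j (r + (z j - τ)) := by
    intro r
    funext i
    by_cases hi : i = j
    · subst hi; simp [hz]; ring
    · simp [hz, hi]
  have hc : HasDerivWithinAt (fun r => r + (z j - τ)) 1 (Set.Icc 0 h) τ :=
    ((hasDerivAt_id τ).add_const _).hasDerivWithinAt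
  have hτz : τ + (z j - τ) = z j := by ring
  have hcomp := HasDerivWithinAt.comp (h₂ := fun r => f (Function.update z j r)) τ
    (by rw [hτz]; exact hd) hc (fun r hr => ?_)
  · rw [mul_one] at hcomp
    simp only [hshift]
    exact hcomp
  · have := hmem r hr j (Set.mem_univ j)
    rw [hshift r] at this
    simpa using this

/-- Mean value inequality for iterated differences: the differences along `L` are bounded by the
corresponding iterated partial derivative. Only the existence of the intermediate derivatives is
used; one difference at a time is traded for the outermost derivative. -/
theorem abs_iterDiff_union_le (L : List (Fin s × ℕ)) {E : Finset (Fin s × ℕ)} {M : ℝ}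
    {f : (Fin s → ℝ) → ℝ} {x : Fin s → ℝ} (hL : L.Nodup) (hLE : ∀ t ∈ L, t ∉ E)
    (hf : HasIterPartial (L.map Prod.fst) f) (hx : 0 ≤ x)
    (hx1 : x + (L.map dyadicShift).sum + ∑ t ∈ E, dyadicShift t ≤ 1)
    (hM : ∀ ξ, x ≤ ξ → ξ ≤ x + (L.map dyadicShift).sum →
      |iterDiff E (iterPartial (L.map Prod.fst) f) ξ| ≤ M) :
    |iterDiff (E ∪ L.toFinset) f x| ≤ (L.map fun t => ((2 : ℝ) ^ t.2)⁻¹).prod * M := by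
  induction L generalizing E M with
  | nil => simpa [iterPartial] using hM x le_rfl (by simp)
  | cons t L ih =>
    rw [List.nodup_cons] at hL
    simp only [List.map_cons, List.sum_cons, List.prod_cons] at hx1 hM ⊢
    have htE : t ∉ E := hLE t List.mem_cons_self
    have hset : E ∪ (t :: L).toFinset = insert t E ∪ L.toFinset := by
      ext u; simp only [Finset.mem_union, List.toFinset_cons, Finset.mem_insert]; tauto
    rw [hset, mul_comm _ (List.prod _), mul_assoc]
    refine ih hL.2 (fun u hu hu' => ?_) hf.1 ?_ ?_
    · rcases Finset.mem_insert.1 hu' with rfl | h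
      · exact hL.1 hu
      · exact hLE u (List.mem_cons_of_mem _ hu) h
    · rw [Finset.sum_insert htE]
      convert hx1 using 1
      abel
    · intro ξ hξ hξ1
      have hξ0 : 0 ≤ ξ := hx.trans hξ
      have hle : ξ + Pi.single t.1 ((2 ^ t.2)⁻¹) + ∑ u ∈ E, dyadicShift u ≤ 1 := by
        refine le_trans ?_ hx1
        rw [← dyadicShift, add_left_comm, add_comm ξ]
        gcongr
      have hmv := Convex.norm_image_sub_le_of_norm_hasDerivWithin_le (C := M)
        (fun τ hτ => hasDerivWithinAt_iterDiff hf.2 E hξ0 hle hτ) (fun τ hτ => ?_)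
        (convex_Icc 0 ((2 ^ t.2)⁻¹ : ℝ)) (Set.left_mem_Icc.2 (by positivity))
        (Set.right_mem_Icc.2 (by positivity))
      · rw [iterDiff_insert htE, abs_sub_comm, mul_comm]
        rw [Pi.single_zero, add_zero, sub_zero, Real.norm_eq_abs, Real.norm_eq_abs,
          abs_of_nonneg (by positivity : (0 : ℝ) ≤ (2 ^ t.2)⁻¹)] at hmv
        exact hmv
      · have h1 : (0 : Fin s → ℝ) ≤ Pi.single t.1 τ := Pi.single_nonneg.2 hτ.1
        have h2 : (Pi.single t.1 τ : Fin s → ℝ) ≤ dyadicShift t := Pi.single_le_single.2 hτ.2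
        refine hM _ (hξ.trans (le_add_of_nonneg_right h1)) ?_
        rw [add_left_comm, add_comm ξ]
        exact add_le_add h2 hξ1

/-! ### Families of disjoint boxes in the Vitali variation -/

theorem boxVol_pos {a b : Fin s → ℝ} (h : ∀ j, a j < b j) : 0 < boxVol a b :=
  Finset.prod_pos fun j _ => sub_pos.2 (h j)

theorem vitaliSum_le_sq {lam : ℝ} {g : (Fin s → ℝ) → ℝ} (hg : vitaliVar lam g < ⊤)
    {P : Finset ((Fin s → ℝ) × (Fin s → ℝ))} (hP : IsBoxPartition P) :
    vitaliSum lam g P ≤ (vitaliVar lam g).toReal ^ 2 := by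
  have h1 : ENNReal.ofReal (Real.sqrt (vitaliSum lam g P)) ≤ vitaliVar lam g :=
    le_iSup₂ (f := fun P (_ : IsBoxPartition P) =>
      ENNReal.ofReal (Real.sqrt (vitaliSum lam g P))) P hP
  have h2 := ENNReal.toReal_mono hg.ne h1
  rw [ENNReal.toReal_ofReal (Real.sqrt_nonneg _)] at h2
  exact (Real.sqrt_le_left ENNReal.toReal_nonneg).1 h2

/-- The reflection `x ↦ 1 - x` exchanges the boxes closed on the left with those closed on the
right, which are the boxes of `BoxIntegral.Box`. -/
theorem mem_halfOpenBox_reflect (B : BoxIntegral.Box (Fin s)) (x : Fin s → ℝ) :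
    x ∈ halfOpenBox (1 - B.upper) (1 - B.lower) ↔ 1 - x ∈ B := by
  rw [halfOpenBox, Set.mem_univ_pi, BoxIntegral.Box.mem_def]
  refine forall_congr' fun j => ?_
  simp only [Set.mem_Ico, Set.mem_Ioc, Pi.sub_apply, Pi.one_apply]
  constructor <;> rintro ⟨h1, h2⟩ <;> constructor <;> linarith

/-- A finite family of disjoint boxes in `[0,1)^s` extends to a partition. -/
theorem exists_isBoxPartition_superset (P : Finset ((Fin s → ℝ) × (Fin s → ℝ)))
    (hlt : ∀ J ∈ P, ∀ j, J.1 j < J.2 j)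
    (hdisj : ∀ J ∈ P, ∀ K ∈ P, J ≠ K → Disjoint (halfOpenBox J.1 J.2) (halfOpenBox K.1 K.2))
    (hsub : ∀ J ∈ P, halfOpenBox J.1 J.2 ⊆ halfOpenBox 0 1) :
    ∃ P', IsBoxPartition P' ∧ P ⊆ P' := by
  classical
  let U : BoxIntegral.Box (Fin s) := ⟨0, 1, fun _ => zero_lt_one⟩
  have hU : ∀ x, x ∈ halfOpenBox (0 : Fin s → ℝ) 1 ↔ 1 - x ∈ U := by
    intro x
    rw [← mem_halfOpenBox_reflect]
    simp [U]
  let box : {J // J ∈ P} → BoxIntegral.Box (Fin s) := fun J =>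
    ⟨1 - J.1.2, 1 - J.1.1, fun j => sub_lt_sub_left (hlt J.1 J.2 j) 1⟩
  have hbox : ∀ J x, x ∈ halfOpenBox J.1.1 J.1.2 ↔ 1 - x ∈ box J := by
    intro J x
    rw [← mem_halfOpenBox_reflect]
    simp [box]
  have hrefl : ∀ y : Fin s → ℝ, 1 - (1 - y) = y := fun y => sub_sub_cancel 1 y
  let π : BoxIntegral.Prepartition U :=
    { boxes := P.attach.image box
      le_of_mem' := by
        intro B hB
        obtain ⟨J, -, rfl⟩ := Finset.mem_image.1 hB
        intro y hy
        rw [← hrefl y, ← hbox] at hy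
        have := (hU _).1 (hsub J.1 J.2 hy)
        rwa [hrefl] at this
      pairwiseDisjoint := by
        intro B hB C hC hBC
        obtain ⟨J, -, rfl⟩ := Finset.mem_image.1 hB
        obtain ⟨K, -, rfl⟩ := Finset.mem_image.1 hC
        have hJK : J.1 ≠ K.1 := fun h => hBC (by rw [Subtype.ext h])
        refine Set.disjoint_left.2 fun y hyJ hyK => ?_
        have hyJ' : y ∈ box J := hyJ
        have hyK' : y ∈ box K := hyK
        rw [← hrefl y, ← hbox] at hyJ' hyK'
        exact Set.disjoint_left.1 (hdisj J.1 J.2 K.1 K.2 hJK) hyJ' hyK' }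
  have hpart := BoxIntegral.Prepartition.isPartitionDisjUnionOfEqDiff π.iUnion_compl
  set π' := π.disjUnion π.compl (π.iUnion_compl.symm ▸ disjoint_sdiff_self_right) with hπ'
  refine ⟨π'.boxes.image fun B => (1 - B.upper, 1 - B.lower), ⟨?_, ?_, ?_⟩, ?_⟩
  · intro J hJ j
    obtain ⟨B, -, rfl⟩ := Finset.mem_image.1 hJ
    exact sub_lt_sub_left (B.lower_lt_upper j) 1
  · intro J hJ K hK hJK
    obtain ⟨B, hB, rfl⟩ := Finset.mem_image.1 hJ
    obtain ⟨C, hC, rfl⟩ := Finset.mem_image.1 hK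
    have hBC : B ≠ C := fun h => hJK (by rw [h])
    refine Set.disjoint_left.2 fun x hx hx' => ?_
    rw [mem_halfOpenBox_reflect] at hx hx'
    exact Set.disjoint_left.1 (π'.pairwiseDisjoint hB hC hBC) hx hx'
  · ext x
    rw [hU]
    simp only [Set.mem_iUnion, Finset.mem_image, exists_prop]
    constructor
    · rintro ⟨J, ⟨B, hB, rfl⟩, hx⟩
      rw [mem_halfOpenBox_reflect] at hx
      exact π'.le_of_mem hB hx
    · intro hx
      obtain ⟨B, hB, hxB⟩ := hpart _ hx
      exact ⟨_, ⟨B, hB, rfl⟩, (mem_halfOpenBox_reflect B x).2 hxB⟩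
  · intro J hJ
    refine Finset.mem_image.2 ⟨box ⟨J, hJ⟩, ?_, ?_⟩
    · exact (BoxIntegral.Prepartition.mem_disjUnion _).2
        (Or.inl (Finset.mem_image_of_mem box (Finset.mem_attach _ _)))
    · simp [box]

/-- The summands of the Vitali variation over any finite family of disjoint boxes, which need not
cover the cube, are controlled by the variation. -/
theorem sum_boxVol_mul_le_sq {lam : ℝ} {g : (Fin s → ℝ) → ℝ} (hg : vitaliVar lam g < ⊤)
    {ι : Type*} (I : Finset ι) (a b : ι → Fin s → ℝ) (hlt : ∀ i ∈ I, ∀ j, a i j < b i j)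
    (hdisj : ∀ i ∈ I, ∀ i' ∈ I, i ≠ i' →
      Disjoint (halfOpenBox (a i) (b i)) (halfOpenBox (a i') (b i')))
    (hsub : ∀ i ∈ I, halfOpenBox (a i) (b i) ⊆ halfOpenBox 0 1) :
    ∑ i ∈ I, boxVol (a i) (b i) * |altSum g (a i) (b i) / boxVol (a i) (b i) ^ lam| ^ 2 ≤
      (vitaliVar lam g).toReal ^ 2 := by
  classical
  have hinj : Set.InjOn (fun i => (a i, b i)) I := by
    intro i hi i' hi' h
    by_contra hne
    have h1 := hdisj i hi i' hi' hne
    obtain ⟨ha, hb⟩ := Prod.mk.inj h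
    rw [← ha, ← hb, disjoint_self] at h1
    have h2 : a i ∈ halfOpenBox (a i) (b i) := fun j _ => Set.left_mem_Ico.2 (hlt i hi j)
    rw [h1] at h2
    exact h2
  obtain ⟨P, hP, hIP⟩ := exists_isBoxPartition_superset (I.image fun i => (a i, b i))
    (by
      intro J hJ
      obtain ⟨i, hi, rfl⟩ := Finset.mem_image.1 hJ
      exact hlt i hi)
    (by
      intro J hJ K hK hJK
      obtain ⟨i, hi, rfl⟩ := Finset.mem_image.1 hJ
      obtain ⟨i', hi', rfl⟩ := Finset.mem_image.1 hK
      exact hdisj i hi i' hi' fun h => hJK (by rw [h]))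
    (by
      intro J hJ
      obtain ⟨i, hi, rfl⟩ := Finset.mem_image.1 hJ
      exact hsub i hi)
  refine le_trans ?_ (vitaliSum_le_sq hg hP)
  rw [vitaliSum]
  refine le_trans (le_of_eq ?_) (Finset.sum_le_sum_of_subset_of_nonneg hIP fun J hJ _ =>
    mul_nonneg (boxVol_pos (hP.lt J hJ)).le (sq_nonneg _))
  rw [Finset.sum_image hinj]

/-! ### Dyadic cells -/

/-- The lower corner of the dyadic cell of index `m` and side lengths `2 ^ (-n j)`. -/
noncomputable def cellCorner (n m : Fin s → ℕ) : Fin s → ℝ := fun j => m j / 2 ^ n j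

/-- The dyadic cell `∏ [m_j 2^(-n_j), (m_j + 1) 2^(-n_j))`, described by the leading digits of its
points. -/
def dyadicCell (n m : Fin s → ℕ) : Set (Fin s → ℝ) :=
  {x | 0 ≤ x ∧ ∀ j, ⌊(2 : ℝ) ^ n j * x j⌋₊ = m j}

/-- Half the side lengths of the dyadic cells, that is, `2 ^ (-(n j + 1))`. -/
noncomputable def halfSide (n : Fin s → ℕ) : Fin s → ℝ := fun j => (2 ^ (n j + 1))⁻¹

theorem halfSide_pos (n : Fin s → ℕ) (j : Fin s) : 0 < halfSide n j := by
  unfold halfSide; positivity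

theorem cellCorner_nonneg (n m : Fin s → ℕ) : 0 ≤ cellCorner n m := fun j => by
  simp only [cellCorner, Pi.zero_apply]; positivity

theorem floor_two_pow_mul_eq_iff {x : ℝ} (hx : 0 ≤ x) (n m : ℕ) :
    ⌊(2 : ℝ) ^ n * x⌋₊ = m ↔ x ∈ Set.Ico ((m : ℝ) / 2 ^ n) ((m + 1 : ℝ) / 2 ^ n) := by
  rw [Nat.floor_eq_iff (by positivity), Set.mem_Ico, div_le_iff₀' (by positivity),
    lt_div_iff₀' (by positivity)]

theorem two_mul_halfSide (n : Fin s → ℕ) (j : Fin s) : 2 * halfSide n j = (2 ^ n j)⁻¹ := by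
  rw [halfSide, pow_succ]; field_simp

theorem dyadicCell_eq_halfOpenBox (n m : Fin s → ℕ) :
    dyadicCell n m =
      halfOpenBox (cellCorner n m) (cellCorner n m + halfSide n + halfSide n) := by
  ext x
  have hb : ∀ j, (cellCorner n m + halfSide n + halfSide n) j = (m j + 1 : ℝ) / 2 ^ n j := by
    intro j
    rw [Pi.add_apply, Pi.add_apply, add_assoc, ← two_mul, two_mul_halfSide, cellCorner]
    ring
  simp only [dyadicCell, halfOpenBox, Set.mem_univ_pi, Set.mem_ofPred_eq, hb]
  constructor
  · rintro ⟨h0, h⟩ j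
    exact (floor_two_pow_mul_eq_iff (h0 j) _ _).1 (h j)
  · intro h
    have h0 : 0 ≤ x := fun j => (cellCorner_nonneg n m j).trans (h j).1
    exact ⟨h0, fun j => (floor_two_pow_mul_eq_iff (h0 j) _ _).2 (h j)⟩

theorem measurableSet_dyadicCell (n m : Fin s → ℕ) : MeasurableSet (dyadicCell n m) := by
  rw [dyadicCell_eq_halfOpenBox]
  exact MeasurableSet.univ_pi fun _ => measurableSet_Ico

theorem disjoint_dyadicCell (n : Fin s → ℕ) {m m' : Fin s → ℕ} (h : m ≠ m') :
    Disjoint (dyadicCell n m) (dyadicCell n m') :=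
  Set.disjoint_left.2 fun _ hx hx' => h (funext fun j => (hx.2 j).symm.trans (hx'.2 j))

/-- The indices of the dyadic cells in `[0,1)^s`. -/
def cellIndices (n : Fin s → ℕ) : Finset (Fin s → ℕ) :=
  Fintype.piFinset fun j => Finset.range (2 ^ n j)

theorem mem_cellIndices {n m : Fin s → ℕ} : m ∈ cellIndices n ↔ ∀ j, m j < 2 ^ n j := by
  simp [cellIndices]

theorem cellCorner_add_le_one {n m : Fin s → ℕ} (hm : m ∈ cellIndices n) :
    cellCorner n m + halfSide n + halfSide n ≤ 1 := by
  intro j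
  rw [Pi.add_apply, Pi.add_apply, add_assoc, ← two_mul, two_mul_halfSide, cellCorner,
    ← one_div, ← add_div, Pi.one_apply, div_le_one (by positivity)]
  exact_mod_cast mem_cellIndices.1 hm j

theorem biUnion_dyadicCell (n : Fin s → ℕ) :
    ⋃ m ∈ cellIndices n, dyadicCell n m = halfOpenBox 0 1 := by
  ext x
  simp only [Set.mem_iUnion, exists_prop]
  constructor
  · rintro ⟨m, hm, hx⟩ j -
    rw [dyadicCell_eq_halfOpenBox] at hx
    exact ⟨(cellCorner_nonneg n m j).trans (hx j trivial).1,
      (hx j trivial).2.trans_le (cellCorner_add_le_one hm j)⟩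
  · intro hx
    refine ⟨fun j => ⌊(2 : ℝ) ^ n j * x j⌋₊, mem_cellIndices.2 fun j => ?_,
      fun j => (hx j trivial).1, fun j => rfl⟩
    have h1 : x j < 1 := (hx j trivial).2
    rw [Nat.floor_lt' (by positivity)]
    push_cast
    exact mul_lt_of_lt_one_right (by positivity) h1

theorem dyadicCell_subset_cube {n m : Fin s → ℕ} (hm : m ∈ cellIndices n) :
    dyadicCell n m ⊆ cube s := by
  intro x hx j _
  have h : x ∈ halfOpenBox (0 : Fin s → ℝ) 1 := by
    rw [← biUnion_dyadicCell n]; exact Set.mem_biUnion hm hx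
  exact ⟨(h j trivial).1, (h j trivial).2.le⟩

/-- Digits finer than the cell can be flipped without leaving it. -/
theorem flipInvariant_dyadicCell {n : Fin s → ℕ} (m : Fin s → ℕ) {T : Finset (Fin s × ℕ)}
    (hT : ∀ t ∈ T, n t.1 < t.2) : FlipInvariant T (dyadicCell n m) := by
  intro t ht x hx hd
  have hfl : ∀ j, ⌊(2 : ℝ) ^ n j * (x + dyadicShift t) j⌋₊ = ⌊(2 : ℝ) ^ n j * x j⌋₊ := by
    intro j
    by_cases hj : j = t.1
    · rw [hj, add_dyadicShift_apply, floor_two_pow_mul_add_of_lt (hx t.1) hd (hT t ht)]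
    · rw [add_dyadicShift_apply_of_ne x t hj]
  simp only [dyadicCell, Set.mem_ofPred_eq, hfl, hx, add_nonneg hx (dyadicShift_nonneg t)]

/-- The positions `(j, n j + 1)` of the leading digits within the cells. -/
def leadingPositions (n : Fin s → ℕ) : Finset (Fin s × ℕ) :=
  Finset.univ.image fun j => (j, n j + 1)

theorem mem_leadingPositions {n : Fin s → ℕ} {t : Fin s × ℕ} :
    t ∈ leadingPositions n ↔ t.2 = n t.1 + 1 := by
  rw [leadingPositions, Finset.mem_image]
  constructor
  · rintro ⟨j, -, rfl⟩; rfl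
  · intro h; exact ⟨t.1, Finset.mem_univ _, Prod.ext rfl h.symm⟩

/-- The points of a cell with leading digits `0` form its lower left corner box. -/
theorem dyadicCell_inter_zeroDigits_subset (n m : Fin s → ℕ) :
    dyadicCell n m ∩ zeroDigits (leadingPositions n) ⊆
      halfOpenBox (cellCorner n m) (cellCorner n m + halfSide n) := by
  rintro x ⟨⟨h0, h1⟩, h2⟩ j -
  have h3 : binaryDigit (x j) (n j + 1) = 0 := h2 (j, n j + 1) (mem_leadingPositions.2 rfl)
  have h4 := floor_two_pow_mul (Nat.le_succ (n j)) (x j)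
  rw [h1 j, Nat.succ_eq_add_one, Nat.add_sub_cancel_left, pow_one] at h4
  rw [binaryDigit] at h3
  have h5 : ⌊(2 : ℝ) ^ (n j + 1) * x j⌋₊ = 2 * m j := by omega
  have h6 := (floor_two_pow_mul_eq_iff (h0 j) _ _).1 h5
  have h7 : ((2 * m j : ℕ) : ℝ) / 2 ^ (n j + 1) = cellCorner n m j := by
    rw [cellCorner, pow_succ]; push_cast; field_simp
  rw [add_div, h7, one_div] at h6
  exact h6

theorem sum_leadingPositions_shift (n : Fin s → ℕ) :
    ∑ t ∈ leadingPositions n, dyadicShift t = halfSide n := by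
  rw [leadingPositions, Finset.sum_image fun a _ b _ h => (Prod.ext_iff.1 h).1]
  funext i
  simp [dyadicShift, halfSide, Finset.sum_apply, Pi.single_apply]

/-- Bound for the integral over a single cell. -/
theorem abs_setIntegral_dyadicCell_le {f : (Fin s → ℝ) → ℝ} {α : ℕ}
    (hf : ContinuousOn f (cube s)) (hderiv : HasMixedDeriv (fun _ => α) f)
    {n m : Fin s → ℕ} (hm : m ∈ cellIndices n) {P : Fin s → Finset ℕ}
    (hP : ∀ j, ∀ p ∈ P j, n j + 1 < p) (hcard : ∀ j, (P j).card = α) {M : ℝ}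
    (hM : ∀ ξ ∈ Set.Icc (cellCorner n m) (cellCorner n m + halfSide n),
      |altSum (mixedDeriv (fun _ => α) f) ξ (ξ + halfSide n)| ≤ M) :
    |∫ x in dyadicCell n m, f x * ∏ j, ∏ l ∈ insert (n j + 1) (P j), rademacher l (x j)| ≤
      boxVol 0 (halfSide n) * (∏ j, ∏ p ∈ P j, ((2 : ℝ) ^ p)⁻¹) * M := by
  classical
  set L : List (Fin s × ℕ) := (List.finRange s).flatMap fun j => (P j).toList.map fun p => (j, p)
    with hLdef
  have hLmem : ∀ t, t ∈ L ↔ t.2 ∈ P t.1 := by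
    rintro ⟨j, p⟩
    simp [hLdef]
  have hLfst : L.map Prod.fst = multiIndexList fun _ => α := by
    rw [hLdef, List.map_flatMap, multiIndexList]
    congr 1
    funext j
    rw [List.map_map, ← hcard j, ← Finset.length_toList (P j)]
    exact List.map_const'
  have hLnodup : L.Nodup := by
    rw [hLdef, List.nodup_flatMap]
    refine ⟨fun j _ => (P j).nodup_toList.map fun a b h => (Prod.ext_iff.1 h).2, ?_⟩
    refine (List.nodup_finRange s).imp fun {i j} hij => ?_
    simp only [Function.onFun, List.disjoint_left, List.mem_map]
    rintro t ⟨p, -, rfl⟩ ⟨q, -, h⟩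
    exact hij (Prod.ext_iff.1 h).1.symm
  set E := leadingPositions n with hE
  set T := E ∪ L.toFinset with hT
  have hTmem : ∀ t, t ∈ T ↔ t.1 ∈ Finset.univ ∧ t.2 ∈ insert (n t.1 + 1) (P t.1) := by
    intro t
    rw [hT, Finset.mem_union, List.mem_toFinset, hLmem, hE, mem_leadingPositions,
      Finset.mem_insert]
    simp
  have hLE : Disjoint L.toFinset E := by
    refine Finset.disjoint_left.2 fun t ht htE => ?_
    have h1 := hP _ _ ((hLmem t).1 (List.mem_toFinset.1 ht))
    rw [mem_leadingPositions.1 htE] at h1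
    exact lt_irrefl _ h1
  have hTn : ∀ t ∈ T, n t.1 < t.2 := by
    intro t ht
    rcases Finset.mem_insert.1 ((hTmem t).1 ht).2 with h | h
    · omega
    · have := hP _ _ h; omega
  have hflip : FlipInvariant T (dyadicCell n m) := flipInvariant_dyadicCell m hTn
  have hsubset : dyadicCell n m ∩ zeroDigits T ⊆
      halfOpenBox (cellCorner n m) (cellCorner n m + halfSide n) := by
    refine Set.Subset.trans ?_ (dyadicCell_inter_zeroDigits_subset n m)
    exact Set.inter_subset_inter_right _ fun x hx t ht => hx t (Finset.mem_union_left _ ht)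
  have hint : IntegrableOn f (dyadicCell n m) :=
    (hf.integrableOn_compact (isCompact_univ_pi fun _ => isCompact_Icc)).mono_set
      (dyadicCell_subset_cube hm)
  have hprod : ∀ x : Fin s → ℝ, ∏ j, ∏ l ∈ insert (n j + 1) (P j), rademacher l (x j) =
      ∏ t ∈ T, rademacher t.2 (x t.1) := fun x => by
    rw [Finset.prod_finset_product T Finset.univ (fun j => insert (n j + 1) (P j)) hTmem]
  have hprodL : ∏ j, ∏ p ∈ P j, ((2 : ℝ) ^ p)⁻¹ =
      (L.map fun t => ((2 : ℝ) ^ t.2)⁻¹).prod := by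
    rw [← List.prod_toFinset _ hLnodup,
      Finset.prod_finset_product L.toFinset Finset.univ P (fun t => by simp [hLmem])]
  simp only [hprod]
  rw [setIntegral_mul_prod_rademacher T (measurableSet_dyadicCell n m) (fun x hx => hx.1) hflip
    hint]
  have hvol : volume.real (halfOpenBox (cellCorner n m) (cellCorner n m + halfSide n)) =
      boxVol 0 (halfSide n) := by
    rw [Measure.real, ← boxVol_eq_volume _ _ (le_add_of_nonneg_right fun j =>
      (halfSide_pos n j).le)]
    simp [boxVol]
  have hfin : volume (halfOpenBox (cellCorner n m) (cellCorner n m + halfSide n)) < ⊤ := by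
    rw [halfOpenBox, Real.volume_pi_Ico]
    exact ENNReal.prod_lt_top fun j _ => ENNReal.ofReal_lt_top
  have hM0 : 0 ≤ M := (abs_nonneg _).trans (hM (cellCorner n m)
    ⟨le_rfl, le_add_of_nonneg_right fun j => (halfSide_pos n j).le⟩)
  have hptw : ∀ x ∈ dyadicCell n m ∩ zeroDigits T,
      ‖iterDiff T f x‖ ≤ (∏ j, ∏ p ∈ P j, ((2 : ℝ) ^ p)⁻¹) * M := by
    intro x hx
    have hx0 : 0 ≤ x := hx.1.1
    -- Raising the digits at the positions in `L` stays in the lower left half of the cell.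
    have hend : x + (L.map dyadicShift).sum ≤ cellCorner n m + halfSide n := by
      have h1 := ((hflip.mono Finset.subset_union_right).inter_zeroDigits hLE).add_sum_mem hx0
        ⟨hx.1, fun t ht => hx.2 t (Finset.mem_union_left _ ht)⟩
        (fun t ht => hx.2 t (Finset.mem_union_right _ ht))
      rw [← List.sum_toFinset _ hLnodup]
      exact fun j => (dyadicCell_inter_zeroDigits_subset n m h1 j trivial).2.le
    rw [Real.norm_eq_abs, hprodL]
    refine abs_iterDiff_union_le L hLnodup
      (fun t ht => Finset.disjoint_left.1 hLE (List.mem_toFinset.2 ht)) ?_ hx0 ?_ ?_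
    · rw [hLfst]; exact hderiv
    · rw [sum_leadingPositions_shift]
      exact (add_le_add_left hend _).trans (cellCorner_add_le_one hm)
    · intro ξ hξ hξ1
      rw [hLfst, hE, leadingPositions, iterDiff_graph_eq_altSum]
      exact hM ξ ⟨fun j => (hsubset hx j trivial).1.trans (hξ j), hξ1.trans hend⟩
  have hb := norm_setIntegral_le_of_norm_le_const ((measure_mono hsubset).trans_lt hfin) hptw
  rw [Real.norm_eq_abs] at hb
  refine hb.trans ?_
  rw [mul_comm, mul_assoc (boxVol _ _)]
  refine mul_le_mul_of_nonneg_right ?_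
    (mul_nonneg (Finset.prod_nonneg fun j _ => Finset.prod_nonneg fun p _ => by positivity) hM0)
  rw [← hvol]
  exact measureReal_mono hsubset hfin.ne

theorem continuousOn_altSum {g : (Fin s → ℝ) → ℝ} (hg : ContinuousOn g (cube s))
    {h : Fin s → ℝ} (hh : 0 ≤ h) {a b : Fin s → ℝ} (ha : 0 ≤ a) (hb : b + h ≤ 1) :
    ContinuousOn (fun ξ => altSum g ξ (ξ + h)) (Set.Icc a b) := by
  unfold altSum
  refine continuousOn_finsetSum _ fun u _ => continuousOn_const.mul (hg.comp ?_ ?_)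
  · refine continuousOn_pi.2 fun j => ?_
    by_cases hj : j ∈ u
    · simp only [hj, if_true]; fun_prop
    · simp only [hj, if_false]; fun_prop
  · intro ξ hξ j _
    have h1 := ha j
    have h2 := hb j
    have h3 := hξ.1 j
    have h4 := hξ.2 j
    have h5 := hh j
    simp only [Pi.add_apply, Pi.zero_apply, Pi.one_apply] at *
    by_cases hj : j ∈ u
    · simp only [hj, if_true]; constructor <;> linarith
    · simp only [hj, if_false]; constructor <;> linarith

/-- The differences of `g` over boxes of half the side length inside each of the cells, chosen as
large as possible, are square-summable with a bound given by the variation. -/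
theorem exists_cell_bounds {g : (Fin s → ℝ) → ℝ} {lam : ℝ} (hg : ContinuousOn g (cube s))
    (hvar : vitaliVar lam g < ⊤) (n : Fin s → ℕ) :
    ∃ M : (Fin s → ℕ) → ℝ,
      (∀ m ∈ cellIndices n, ∀ ξ ∈ Set.Icc (cellCorner n m) (cellCorner n m + halfSide n),
        |altSum g ξ (ξ + halfSide n)| ≤ M m) ∧
      boxVol 0 (halfSide n) * ∑ m ∈ cellIndices n, M m ^ 2 ≤
        (boxVol 0 (halfSide n) ^ lam * (vitaliVar lam g).toReal) ^ 2 := by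
  have hh : 0 ≤ halfSide n := fun j => (halfSide_pos n j).le
  have hex : ∀ m : Fin s → ℕ, ∃ ξ, m ∈ cellIndices n →
      ξ ∈ Set.Icc (cellCorner n m) (cellCorner n m + halfSide n) ∧
      ∀ η ∈ Set.Icc (cellCorner n m) (cellCorner n m + halfSide n),
        |altSum g η (η + halfSide n)| ≤ |altSum g ξ (ξ + halfSide n)| := by
    intro m
    by_cases hm : m ∈ cellIndices n
    · obtain ⟨ξ, hξ, hmax⟩ := (isCompact_Icc (a := cellCorner n m)
        (b := cellCorner n m + halfSide n)).exists_isMaxOn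
        (Set.nonempty_Icc.2 (le_add_of_nonneg_right hh))
        (continuousOn_altSum hg hh (cellCorner_nonneg n m) (cellCorner_add_le_one hm)).abs
      exact ⟨ξ, fun _ => ⟨hξ, fun η hη => hmax hη⟩⟩
    · exact ⟨0, fun h => absurd h hm⟩
  choose ξ hξ using hex
  refine ⟨fun m => |altSum g (ξ m) (ξ m + halfSide n)|, fun m hm => (hξ m hm).2, ?_⟩
  have hcell : ∀ m ∈ cellIndices n,
      halfOpenBox (ξ m) (ξ m + halfSide n) ⊆ dyadicCell n m := by
    intro m hm
    rw [dyadicCell_eq_halfOpenBox]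
    refine Set.pi_mono fun j _ => Set.Ico_subset_Ico ((hξ m hm).1.1 j) ?_
    exact add_le_add_left ((hξ m hm).1.2 j) _
  have hvolm : ∀ m, boxVol (ξ m) (ξ m + halfSide n) = boxVol 0 (halfSide n) := by
    intro m; simp [boxVol]
  have hsum := sum_boxVol_mul_le_sq hvar (cellIndices n) ξ (fun m => ξ m + halfSide n)
    (fun m _ j => lt_add_of_pos_right _ (halfSide_pos n j))
    (fun m hm m' hm' hne => (disjoint_dyadicCell n hne).mono (hcell m hm) (hcell m' hm'))
    (fun m hm => by
      refine (hcell m hm).trans ?_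
      rw [← biUnion_dyadicCell n]
      exact Set.subset_biUnion_of_mem (u := fun m => dyadicCell n m) hm)
  have hv : 0 < boxVol 0 (halfSide n) := boxVol_pos (halfSide_pos n)
  have hvl : 0 < boxVol 0 (halfSide n) ^ lam := Real.rpow_pos_of_pos hv lam
  rw [mul_pow, ← div_le_iff₀' (by positivity), Finset.mul_sum, Finset.sum_div]
  refine le_trans (le_of_eq ?_) hsum
  refine Finset.sum_congr rfl fun m _ => ?_
  rw [hvolm, abs_div, abs_of_pos hvl, div_pow, mul_div_assoc]

/-! ### Parseval's identity for the lower digits -/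

/-- The value of the Rademacher function `l` on the `m`-th dyadic interval of length `2 ^ (-n)`,
where `l ≤ n`. -/
def cellSign (n m l : ℕ) : ℝ := (-1) ^ (m / 2 ^ (n - l))

theorem rademacher_eq_cellSign {n m : Fin s → ℕ} {x : Fin s → ℝ} (hx : x ∈ dyadicCell n m)
    (j : Fin s) {l : ℕ} (hl : l ≤ n j) : rademacher l (x j) = cellSign (n j) (m j) l := by
  rw [rademacher, binaryDigit, floor_two_pow_mul hl, hx.2 j, cellSign,
    ← neg_one_pow_eq_pow_mod_two]

theorem cellSign_mul_eq (n m m' l : ℕ) :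
    cellSign n m l * cellSign n m' l =
      if (m / 2 ^ (n - l)) % 2 = (m' / 2 ^ (n - l)) % 2 then 1 else -1 := by
  rw [cellSign, cellSign, neg_one_pow_eq_pow_mod_two, neg_one_pow_eq_pow_mod_two (m' / _)]
  rcases Nat.mod_two_eq_zero_or_one (m / 2 ^ (n - l)) with h | h <;>
  rcases Nat.mod_two_eq_zero_or_one (m' / 2 ^ (n - l)) with h' | h' <;> simp [h, h']

theorem sum_prod_cellSign (n : ℕ) {m m' : ℕ} (hm : m < 2 ^ n) (hm' : m' < 2 ^ n) :
    ∑ K ∈ (Finset.Icc 1 n).powerset,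
      (∏ l ∈ K, cellSign n m l) * ∏ l ∈ K, cellSign n m' l = if m = m' then 2 ^ n else 0 := by
  simp only [← Finset.prod_mul_distrib]
  rw [← Finset.prod_one_add]
  split_ifs with h
  · subst h
    simp only [cellSign_mul_eq, if_true]
    norm_num
  · obtain ⟨i, hi⟩ : ∃ i, m.testBit i ≠ m'.testBit i := by
      by_contra! hcon
      exact h (Nat.eq_of_testBit_eq hcon)
    have hin : i < n := by
      by_contra! hni
      have h2 := Nat.pow_le_pow_right (n := 2) (by norm_num) hni
      rw [Nat.testBit_lt_two_pow (hm.trans_le h2), Nat.testBit_lt_two_pow (hm'.trans_le h2)] at hi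
      exact hi rfl
    refine Finset.prod_eq_zero (i := n - i) (Finset.mem_Icc.2 ⟨by omega, by omega⟩) ?_
    have h3 : (m / 2 ^ (n - (n - i))) % 2 ≠ (m' / 2 ^ (n - (n - i))) % 2 := by
      rw [show n - (n - i) = i by omega]
      intro h4
      apply hi
      simp only [Nat.testBit_eq_decide_div_mod_eq, h4]
    rw [cellSign_mul_eq, if_neg h3]
    norm_num

/-- The families of sets of bit positions in `1, …, n j`, the digits that are constant on the
cells. -/
def lowBits (n : Fin s → ℕ) : Finset (Fin s → Finset ℕ) :=
  Fintype.piFinset fun j => (Finset.Icc 1 (n j)).powerset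

theorem parseval_cells (n : Fin s → ℕ) (A : (Fin s → ℕ) → ℝ) :
    ∑ K ∈ lowBits n,
      (∑ m ∈ cellIndices n, (∏ j, ∏ l ∈ K j, cellSign (n j) (m j) l) * A m) ^ 2 =
      (∏ j, (2 : ℝ) ^ n j) * ∑ m ∈ cellIndices n, A m ^ 2 := by
  have horth : ∀ m ∈ cellIndices n, ∀ m' ∈ cellIndices n,
      ∑ K ∈ lowBits n, (∏ j, ∏ l ∈ K j, cellSign (n j) (m j) l) *
        ∏ j, ∏ l ∈ K j, cellSign (n j) (m' j) l =
        if m = m' then ∏ j, (2 : ℝ) ^ n j else 0 := by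
    intro m hm m' hm'
    simp only [← Finset.prod_mul_distrib (s := Finset.univ), lowBits]
    rw [← Finset.prod_univ_sum (fun j => (Finset.Icc 1 (n j)).powerset)
      (fun j K => (∏ l ∈ K, cellSign (n j) (m j) l) * ∏ l ∈ K, cellSign (n j) (m' j) l)]
    rw [Finset.prod_congr rfl fun j _ => sum_prod_cellSign (n j) (mem_cellIndices.1 hm j)
      (mem_cellIndices.1 hm' j)]
    split_ifs with h
    · simp [h]
    · obtain ⟨j, hj⟩ := Function.ne_iff.1 h
      exact Finset.prod_eq_zero (Finset.mem_univ j) (if_neg hj)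
  simp only [sq, Finset.sum_mul_sum]
  rw [Finset.sum_comm]
  simp only [Finset.mul_sum]
  refine Finset.sum_congr rfl fun m hm => ?_
  rw [Finset.sum_comm]
  have h1 : ∀ m' ∈ cellIndices n, ∑ K ∈ lowBits n,
      (∏ j, ∏ l ∈ K j, cellSign (n j) (m j) l) * A m *
        ((∏ j, ∏ l ∈ K j, cellSign (n j) (m' j) l) * A m') =
      if m = m' then (∏ j, (2 : ℝ) ^ n j) * (A m * A m') else 0 := by
    intro m' hm'
    have h2 := horth m hm m' hm'
    rw [← ite_zero_mul, ← h2, Finset.sum_mul]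
    refine Finset.sum_congr rfl fun K _ => by ring
  rw [Finset.sum_congr rfl h1, Finset.sum_ite_eq, if_pos hm]

/-! ### Walsh coefficients indexed by sets of bits -/

/-- The Walsh coefficient for the frequencies whose sets of nonzero bits are `κ j`. -/
noncomputable def bitCoeff (f : (Fin s → ℝ) → ℝ) (κ : Fin s → Finset ℕ) : ℝ :=
  ∫ x in cube s, f x * ∏ j, ∏ l ∈ κ j, rademacher l (x j)

theorem walshCoeff_eq_bitCoeff (f : (Fin s → ℝ) → ℝ) (k : Fin s → ℕ) :
    walshCoeff f k = bitCoeff f fun j => nonzeroBits (k j) := by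
  simp only [walshCoeff, bitCoeff, walsh_eq_prod_rademacher]

theorem integrableOn_mul_prod_prod_rademacher {f : (Fin s → ℝ) → ℝ} {Q : Set (Fin s → ℝ)}
    (hf : IntegrableOn f Q) (κ : Fin s → Finset ℕ) :
    IntegrableOn (fun x => f x * ∏ j, ∏ l ∈ κ j, rademacher l (x j)) Q := by
  refine (integrableOn_mul_prod_rademacher hf
    ((Finset.univ.sigma κ).map (Equiv.sigmaEquivProd _ _).toEmbedding)).congr_fun_ae ?_
  filter_upwards with x
  simp [Finset.prod_sigma]

/-- The bits below the cell size contribute a sign on each cell. -/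
theorem bitCoeff_union_eq_sum {f : (Fin s → ℝ) → ℝ} (hf : IntegrableOn f (cube s))
    {n : Fin s → ℕ} {K T : Fin s → Finset ℕ} (hK : K ∈ lowBits n)
    (hT : ∀ j, ∀ l ∈ T j, n j < l) :
    bitCoeff f (fun j => K j ∪ T j) = ∑ m ∈ cellIndices n,
      (∏ j, ∏ l ∈ K j, cellSign (n j) (m j) l) *
        ∫ x in dyadicCell n m, f x * ∏ j, ∏ l ∈ T j, rademacher l (x j) := by
  have hKn : ∀ j, ∀ l ∈ K j, l ≤ n j := fun j l hl =>
    (Finset.mem_Icc.1 (Finset.mem_powerset.1 (Fintype.mem_piFinset.1 hK j) hl)).2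
  have hcube : (cube s : Set (Fin s → ℝ)) =ᵐ[volume] halfOpenBox (0 : Fin s → ℝ) 1 := by
    have h := Measure.univ_pi_Ico_ae_eq_Icc (μ := fun _ : Fin s => (volume : Measure ℝ))
      (f := 0) (g := 1)
    rw [← Set.pi_univ_Icc] at h
    exact h.symm
  rw [bitCoeff, setIntegral_congr_set hcube, ← biUnion_dyadicCell n,
    integral_biUnion_finset _ (fun m _ => measurableSet_dyadicCell n m)
      (fun m _ m' _ h => disjoint_dyadicCell n h)
      (fun m hm => integrableOn_mul_prod_prod_rademacher
        (hf.mono_set (dyadicCell_subset_cube hm)) _)]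
  refine Finset.sum_congr rfl fun m _ => ?_
  rw [← integral_const_mul]
  refine setIntegral_congr_fun (measurableSet_dyadicCell n m) fun x hx => ?_
  have h1 : ∀ j, ∏ l ∈ K j ∪ T j, rademacher l (x j) =
      (∏ l ∈ K j, cellSign (n j) (m j) l) * ∏ l ∈ T j, rademacher l (x j) := by
    intro j
    rw [Finset.prod_union]
    · congr 1
      exact Finset.prod_congr rfl fun l hl => rademacher_eq_cellSign hx j (hKn j l hl)
    · exact Finset.disjoint_left.2 fun l hl hl' => (hKn j l hl).not_gt (hT j l hl')
  simp only [h1, Finset.prod_mul_distrib]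
  ring

/-- The contribution of all frequencies with prescribed bits from position `n j + 1` on. -/
theorem sum_lowBits_bitCoeff_sq_le {f : (Fin s → ℝ) → ℝ} {α : ℕ} {lam : ℝ}
    (hf : ContinuousOn f (cube s)) (hderiv : HasMixedDeriv (fun _ => α) f)
    (hcont : ContinuousOn (mixedDeriv (fun _ => α) f) (cube s))
    (hvar : vitaliVar lam (mixedDeriv (fun _ => α) f) < ⊤)
    (n : Fin s → ℕ) {P : Fin s → Finset ℕ}
    (hP : ∀ j, ∀ p ∈ P j, n j + 1 < p) (hcard : ∀ j, (P j).card = α) :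
    ∑ K ∈ lowBits n, bitCoeff f (fun j => K j ∪ insert (n j + 1) (P j)) ^ 2 ≤
      (1 / 2) ^ s * (∏ j, ∏ p ∈ P j, ((4 : ℝ) ^ p)⁻¹) *
        (boxVol 0 (halfSide n) ^ lam * (vitaliVar lam (mixedDeriv (fun _ => α) f)).toReal) ^ 2 := by
  obtain ⟨M, hM, hMsum⟩ := exists_cell_bounds hcont hvar n
  have hint : IntegrableOn f (cube s) :=
    hf.integrableOn_compact (isCompact_univ_pi fun _ => isCompact_Icc)
  set c : ℝ := ∏ j, ∏ p ∈ P j, ((2 : ℝ) ^ p)⁻¹ with hc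
  have hc2 : c ^ 2 = ∏ j, ∏ p ∈ P j, ((4 : ℝ) ^ p)⁻¹ := by
    rw [hc]
    simp only [← Finset.prod_pow]
    refine Finset.prod_congr rfl fun j _ => Finset.prod_congr rfl fun p _ => ?_
    rw [inv_pow, ← pow_mul, mul_comm, pow_mul]
    norm_num
  set v := boxVol 0 (halfSide n) with hv
  have hv0 : 0 < v := boxVol_pos (halfSide_pos n)
  have hNv : (∏ j, (2 : ℝ) ^ n j) * v = (1 / 2) ^ s := by
    have h1 : ∀ j, (2 : ℝ) ^ n j * (halfSide n j - (0 : Fin s → ℝ) j) = 1 / 2 := by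
      intro j
      rw [halfSide, pow_succ, Pi.zero_apply]; field_simp; norm_num
    rw [hv, boxVol, ← Finset.prod_mul_distrib, Finset.prod_congr rfl fun j _ => h1 j]
    simp
  have hT : ∀ j, ∀ l ∈ insert (n j + 1) (P j), n j < l := by
    intro j l hl
    rcases Finset.mem_insert.1 hl with h | h
    · omega
    · have := hP j l h; omega
  rw [Finset.sum_congr rfl fun K hK => by rw [bitCoeff_union_eq_sum hint hK hT],
    parseval_cells, ← hc2]
  calc (∏ j, (2 : ℝ) ^ n j) * ∑ m ∈ cellIndices n,
        (∫ x in dyadicCell n m, f x * ∏ j, ∏ l ∈ insert (n j + 1) (P j), rademacher l (x j)) ^ 2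
      ≤ (∏ j, (2 : ℝ) ^ n j) * ∑ m ∈ cellIndices n, (v * c * M m) ^ 2 := by
        refine mul_le_mul_of_nonneg_left (Finset.sum_le_sum fun m hm => ?_)
          (Finset.prod_nonneg fun j _ => by positivity)
        exact sq_le_sq.2 ((abs_setIntegral_dyadicCell_le hf hderiv hm hP hcard (hM m hm)).trans
          (le_abs_self _))
    _ = ((∏ j, (2 : ℝ) ^ n j) * v) * c ^ 2 * (v * ∑ m ∈ cellIndices n, M m ^ 2) := by
        simp only [mul_pow, ← Finset.mul_sum]
        ring
    _ ≤ _ := by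
        rw [hNv]
        gcongr

/-! ### Summation over the upper bits -/

theorem prod_one_add_inv_four_pow_le (d : ℕ) :
    ∏ i ∈ Finset.range d, (1 + ((4 : ℝ) ^ (i + 1))⁻¹) ≤ 2 - ((4 : ℝ) ^ d)⁻¹ := by
  induction d with
  | zero => norm_num
  | succ d ih =>
    rw [Finset.prod_range_succ, pow_succ, mul_inv]
    have h0 : (0 : ℝ) < ((4 : ℝ) ^ d)⁻¹ := by positivity
    refine (mul_le_mul_of_nonneg_right ih (by positivity)).trans ?_
    nlinarith

/-- The factor `2` is absorbed by the factor `1 / 2` in `sum_lowBits_bitCoeff_sq_le`. -/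
theorem sum_powersetCard_prod_inv_le (α a b : ℕ) :
    ∑ P ∈ (Finset.Ioc a b).powersetCard α, ∏ p ∈ P, ((4 : ℝ) ^ p)⁻¹ ≤
      2 * ((4 : ℝ) ^ (α * a))⁻¹ := by
  have h1 : ∀ P ∈ (Finset.Ioc a b).powersetCard α, ∏ p ∈ P, ((4 : ℝ) ^ p)⁻¹ =
      ((4 : ℝ) ^ (α * a))⁻¹ * ∏ p ∈ P, ((4 : ℝ) ^ (p - a))⁻¹ := by
    intro P hP
    obtain ⟨hPs, hPc⟩ := Finset.mem_powersetCard.1 hP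
    have h2 : ((4 : ℝ) ^ (α * a))⁻¹ = ∏ _p ∈ P, ((4 : ℝ) ^ a)⁻¹ := by
      rw [Finset.prod_const, hPc, inv_pow, ← pow_mul, mul_comm]
    rw [h2, ← Finset.prod_mul_distrib]
    refine Finset.prod_congr rfl fun p hp => ?_
    have h3 := (Finset.mem_Ioc.1 (hPs hp)).1
    rw [← mul_inv, ← pow_add, Nat.add_sub_cancel' h3.le]
  rw [Finset.sum_congr rfl h1, ← Finset.mul_sum, mul_comm]
  refine mul_le_mul_of_nonneg_right ?_ (by positivity)
  have hIoc : Finset.Ioc a b = (Finset.range (b - a)).image fun i => a + 1 + i := by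
    ext p
    simp only [Finset.mem_Ioc, Finset.mem_image, Finset.mem_range]
    exact ⟨fun h => ⟨p - a - 1, by omega, by omega⟩, by rintro ⟨i, hi, rfl⟩; omega⟩
  calc ∑ P ∈ (Finset.Ioc a b).powersetCard α, ∏ p ∈ P, ((4 : ℝ) ^ (p - a))⁻¹
      ≤ ∑ P ∈ (Finset.Ioc a b).powerset, ∏ p ∈ P, ((4 : ℝ) ^ (p - a))⁻¹ :=
        Finset.sum_le_sum_of_subset_of_nonneg
          (fun P hP => Finset.mem_powerset.2 (Finset.mem_powersetCard.1 hP).1)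
          fun P _ _ => Finset.prod_nonneg fun p _ => by positivity
    _ = ∏ i ∈ Finset.range (b - a), (1 + ((4 : ℝ) ^ (i + 1))⁻¹) := by
        rw [← Finset.prod_one_add, hIoc, Finset.prod_image fun i _ i' _ h => by simpa using h]
        refine Finset.prod_congr rfl fun i _ => ?_
        rw [show a + 1 + i - a = i + 1 by omega]
    _ ≤ 2 := (prod_one_add_inv_four_pow_le _).trans (sub_le_self _ (by positivity))

/-! ### The bits of the frequencies -/

theorem nonzeroBits_injective : Function.Injective nonzeroBits := by
  intro a b h
  refine Nat.eq_of_testBit_eq fun i => ?_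
  have h1 := mem_nonzeroBits a (i + 1)
  rw [h, mem_nonzeroBits] at h1
  simp only [Nat.add_sub_cancel, Nat.le_add_left, true_and] at h1
  exact Bool.eq_iff_iff.2 h1.symm

/-- If the `q + 1`-st largest element of `κ` is `l > 0`, then `l` is an element and has exactly `q`
larger ones. -/
theorem mem_and_card_of_nthLargest {κ : Finset ℕ} {q l : ℕ} (h : nthLargest κ (q + 1) = l)
    (hl : 1 ≤ l) : l ∈ κ ∧ (κ.filter (l < ·)).card = q := by
  set S := κ.sort (fun a b => b ≤ a) with hS
  have hSmem : ∀ p, p ∈ S ↔ p ∈ κ := fun p => Finset.mem_sort _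
  have hSlt : S.SortedGT := Finset.sortedGT_sort κ
  rw [nthLargest, Nat.add_sub_cancel, ← hS] at h
  have hq : q < S.length := by
    by_contra! hq
    rw [List.getD_eq_default _ _ hq] at h
    omega
  rw [List.getD_eq_getElem _ _ hq] at h
  refine ⟨(hSmem l).1 (h ▸ List.getElem_mem hq), ?_⟩
  have hfil : κ.filter (l < ·) = (S.take q).toFinset := by
    ext p
    rw [Finset.mem_filter, List.mem_toFinset, ← hSmem, List.mem_take_iff_getElem,
      List.mem_iff_getElem]
    constructor
    · rintro ⟨⟨i, hi, rfl⟩, hlp⟩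
      refine ⟨i, lt_min ?_ hi, rfl⟩
      rw [← h] at hlp
      by_contra! hqi
      exact hlp.not_ge (hSlt.getElem_le_getElem_iff.2 hqi)
    · rintro ⟨i, hi, rfl⟩
      have hi' := lt_min_iff.1 hi
      refine ⟨⟨i, hi'.2, rfl⟩, ?_⟩
      rw [← h]
      exact hSlt.getElem_lt_getElem_iff.2 hi'.1
  rw [hfil, List.toFinset_card_of_nodup (hSlt.nodup.sublist (List.take_sublist q S)),
    List.length_take, min_eq_left hq.le]

/-- The frequencies of a finite part of the class are sorted by their bits above position
`n j + 1`; the remaining free bits are the lower ones. -/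
theorem sum_walshCoeff_sq_le_sum_bitCoeff_sq (f : (Fin s → ℝ) → ℝ) (α : ℕ) (n : Fin s → ℕ)
    (S : Finset (bitClass (α + 1) fun j => n j + 1)) :
    ∃ b, ∑ k ∈ S, |walshCoeff f k| ^ 2 ≤
      ∑ P ∈ Fintype.piFinset fun j => (Finset.Ioc (n j + 1) b).powersetCard α,
        ∑ K ∈ lowBits n, bitCoeff f (fun j => K j ∪ insert (n j + 1) (P j)) ^ 2 := by
  classical
  let B : (bitClass (α + 1) fun j => n j + 1) → ℕ := fun k =>
    Finset.univ.sup fun j => (nonzeroBits (k.1 j)).sup id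
  have hbits : ∀ k ∈ S, ∀ j, ∀ l ∈ nonzeroBits (k.1 j), l ≤ S.sup B := by
    intro k hk j l hl
    have h1 : l ≤ (nonzeroBits (k.1 j)).sup id := Finset.le_sup (f := id) hl
    have h2 : (nonzeroBits (k.1 j)).sup id ≤ B k :=
      Finset.le_sup (f := fun j => (nonzeroBits (k.1 j)).sup id) (Finset.mem_univ j)
    have h3 : B k ≤ S.sup B := Finset.le_sup hk
    exact h1.trans (h2.trans h3)
  let e : bitClass (α + 1) (fun j => n j + 1) → (Fin s → Finset ℕ) × (Fin s → Finset ℕ) :=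
    fun k => (fun j => (nonzeroBits (k.1 j)).filter (n j + 1 < ·),
      fun j => (nonzeroBits (k.1 j)).filter (· < n j + 1))
  have hclass : ∀ (k : bitClass (α + 1) fun j => n j + 1) j, n j + 1 ∈ nonzeroBits (k.1 j) ∧
      ((nonzeroBits (k.1 j)).filter (n j + 1 < ·)).card = α := fun k j =>
    mem_and_card_of_nthLargest (k.2.2 j) (Nat.le_add_left 1 (n j))
  have he : ∀ k, (fun j => (e k).2 j ∪ insert (n j + 1) ((e k).1 j)) =
      fun j => nonzeroBits (k.1 j) := by
    intro k
    funext j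
    ext l
    simp only [e, Finset.mem_union, Finset.mem_insert, Finset.mem_filter]
    have h1 := (hclass k j).1
    constructor
    · rintro (h | rfl | h)
      · exact h.1
      · exact h1
      · exact h.1
    · intro h
      rcases lt_trichotomy l (n j + 1) with h2 | h2 | h2
      · exact Or.inl ⟨h, h2⟩
      · exact Or.inr (Or.inl h2)
      · exact Or.inr (Or.inr ⟨h, h2⟩)
  have hmem : ∀ k ∈ S,
      e k ∈ (Fintype.piFinset fun j => (Finset.Ioc (n j + 1) (S.sup B)).powersetCard α) ×ˢ
        lowBits n := by
    intro k hk
    rw [Finset.mem_product, Fintype.mem_piFinset, lowBits, Fintype.mem_piFinset]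
    refine ⟨fun j => Finset.mem_powersetCard.2 ⟨fun l hl => ?_, (hclass k j).2⟩,
      fun j => Finset.mem_powerset.2 fun l hl => ?_⟩
    · obtain ⟨h1, h2⟩ := Finset.mem_filter.1 hl
      exact Finset.mem_Ioc.2 ⟨h2, hbits k hk j l h1⟩
    · obtain ⟨h1, h2⟩ := Finset.mem_filter.1 hl
      exact Finset.mem_Icc.2 ⟨((mem_nonzeroBits _ _).1 h1).1, Nat.lt_succ_iff.1 h2⟩
  clear_value e
  have hinj : Function.Injective e := by
    intro k k' h
    have h1 := he k
    rw [h, he k'] at h1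
    have h2 : k'.1 = k.1 := funext fun j => nonzeroBits_injective (congrFun h1 j)
    exact Subtype.ext h2.symm
  have hsum : ∑ k ∈ S, |walshCoeff f k| ^ 2 = ∑ y ∈ S.image e,
      bitCoeff f (fun j => y.2 j ∪ insert (n j + 1) (y.1 j)) ^ 2 := by
    rw [Finset.sum_image hinj.injOn]
    exact Finset.sum_congr rfl fun k _ => by rw [he, sq_abs, walshCoeff_eq_bitCoeff]
  have hsub : S.image e ⊆
      (Fintype.piFinset fun j => (Finset.Ioc (n j + 1) (S.sup B)).powersetCard α) ×ˢ
        lowBits n := by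
    intro y hy
    obtain ⟨k, hk, rfl⟩ := Finset.mem_image.1 hy
    exact hmem k hk
  have hle := Finset.sum_le_sum_of_subset_of_nonneg hsub fun y _ _ =>
    sq_nonneg (bitCoeff f fun j => y.2 j ∪ insert (n j + 1) (y.1 j))
  rw [← hsum, Finset.sum_product] at hle
  exact ⟨S.sup B, hle⟩

theorem boxVol_halfSide (n : Fin s → ℕ) :
    boxVol 0 (halfSide n) = (2 : ℝ) ^ (-∑ j, ((n j + 1 : ℕ) : ℝ)) := by
  rw [← Finset.sum_neg_distrib, Real.rpow_sum_of_pos (by norm_num)]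
  refine Finset.prod_congr rfl fun j _ => ?_
  rw [Pi.zero_apply, sub_zero, halfSide, Real.rpow_neg (by norm_num), Real.rpow_natCast]

/-! ### The bound for the whole class -/

/-- The asserted bound for finitely many frequencies, with `ℓ j = n j + 1`. -/
theorem sum_walshCoeff_sq_le {f : (Fin s → ℝ) → ℝ} {α : ℕ} {lam : ℝ}
    (hf : ContinuousOn f (cube s)) (hderiv : HasMixedDeriv (fun _ => α) f)
    (hcont : ContinuousOn (mixedDeriv (fun _ => α) f) (cube s))
    (hvar : vitaliVar lam (mixedDeriv (fun _ => α) f) < ⊤) (n : Fin s → ℕ)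
    (S : Finset (bitClass (α + 1) fun j => n j + 1)) :
    ∑ k ∈ S, |walshCoeff f k| ^ 2 ≤ ((vitaliVar lam (mixedDeriv (fun _ => α) f)).toReal *
      (2 : ℝ) ^ (-((α : ℝ) + lam) * ∑ j, ((n j + 1 : ℕ) : ℝ))) ^ 2 := by
  obtain ⟨b, hb⟩ := sum_walshCoeff_sq_le_sum_bitCoeff_sq f α n S
  set V := (vitaliVar lam (mixedDeriv (fun _ => α) f)).toReal with hV
  set v := boxVol 0 (halfSide n) with hv
  set U := Fintype.piFinset fun j => (Finset.Ioc (n j + 1) b).powersetCard α with hU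
  have hv0 : 0 < v := boxVol_pos (halfSide_pos n)
  have hP : ∑ P ∈ U, ∏ j, ∏ p ∈ P j, ((4 : ℝ) ^ p)⁻¹ ≤ 2 ^ s * (v ^ α) ^ 2 := by
    rw [hU, ← Finset.prod_univ_sum (fun j => (Finset.Ioc (n j + 1) b).powersetCard α)
      (fun _ P => ∏ p ∈ P, ((4 : ℝ) ^ p)⁻¹)]
    calc _ ≤ ∏ j, (2 * ((4 : ℝ) ^ (α * (n j + 1)))⁻¹) :=
          Finset.prod_le_prod (fun j _ => Finset.sum_nonneg fun P _ =>
            Finset.prod_nonneg fun p _ => by positivity)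
            fun j _ => sum_powersetCard_prod_inv_le α (n j + 1) b
      _ = 2 ^ s * (v ^ α) ^ 2 := by
          rw [Finset.prod_mul_distrib, Finset.prod_const, Finset.card_univ, Fintype.card_fin, hv,
            boxVol, ← pow_mul, ← Finset.prod_pow]
          congr 1
          refine Finset.prod_congr rfl fun j _ => ?_
          rw [Pi.zero_apply, sub_zero, halfSide, inv_pow, ← pow_mul,
            show (n j + 1) * (α * 2) = 2 * (α * (n j + 1)) by ring, pow_mul 2 2]
          norm_num
  have htarget : (2 : ℝ) ^ (-((α : ℝ) + lam) * ∑ j, ((n j + 1 : ℕ) : ℝ)) = v ^ α * v ^ lam := by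
    rw [← Real.rpow_natCast v α, ← Real.rpow_add hv0, hv, boxVol_halfSide,
      ← Real.rpow_mul (by norm_num)]
    congr 1
    ring
  calc ∑ k ∈ S, |walshCoeff f k| ^ 2
      ≤ ∑ P ∈ U, ∑ K ∈ lowBits n, bitCoeff f (fun j => K j ∪ insert (n j + 1) (P j)) ^ 2 := hb
    _ ≤ ∑ P ∈ U, (1 / 2) ^ s * (∏ j, ∏ p ∈ P j, ((4 : ℝ) ^ p)⁻¹) * (v ^ lam * V) ^ 2 := by
        refine Finset.sum_le_sum fun P hPmem => ?_
        have h1 := fun j => Finset.mem_powersetCard.1 (Fintype.mem_piFinset.1 hPmem j)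
        exact sum_lowBits_bitCoeff_sq_le hf hderiv hcont hvar n
          (fun j p hp => (Finset.mem_Ioc.1 ((h1 j).1 hp)).1) fun j => (h1 j).2
    _ = (1 / 2) ^ s * (∑ P ∈ U, ∏ j, ∏ p ∈ P j, ((4 : ℝ) ^ p)⁻¹) * (v ^ lam * V) ^ 2 := by
        rw [← Finset.sum_mul, ← Finset.mul_sum]
    _ ≤ (1 / 2) ^ s * (2 ^ s * (v ^ α) ^ 2) * (v ^ lam * V) ^ 2 := by gcongr
    _ = _ := by
        rw [htarget, ← mul_assoc ((1 / 2 : ℝ) ^ s), ← mul_pow]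
        norm_num
        ring

end WalshDecay

theorem mainTheorem5 (s : ℕ) (hs : 1 ≤ s) (α : ℕ) (lam : ℝ) (hlam0 : 0 < lam) (hlam1 : lam ≤ 1)
    (f : (Fin s → ℝ) → ℝ) (hf : ContinuousOn f (WalshDecay.cube s))
    (hderiv : WalshDecay.HasMixedDeriv (fun _ => α) f)
    (hcont : ContinuousOn (WalshDecay.mixedDeriv (fun _ => α) f) (WalshDecay.cube s))
    (hvar : WalshDecay.vitaliVar lam (WalshDecay.mixedDeriv (fun _ => α) f) < ⊤)
    (ℓ : Fin s → ℕ) (hℓ : ∀ j, 1 ≤ ℓ j) :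
    Summable (fun k : WalshDecay.bitClass (α + 1) ℓ => |WalshDecay.walshCoeff f k| ^ 2) ∧
      Real.sqrt (∑' k : WalshDecay.bitClass (α + 1) ℓ, |WalshDecay.walshCoeff f k| ^ 2) ≤
        (WalshDecay.vitaliVar lam (WalshDecay.mixedDeriv (fun _ => α) f)).toReal *
          (2 : ℝ) ^ (-((α : ℝ) + lam) * ∑ j, (ℓ j : ℝ)) := by
  -- The bits below `ℓ j` have positions `1, …, n j`.
  obtain ⟨n, rfl⟩ : ∃ n : Fin s → ℕ, ℓ = fun j => n j + 1 :=
    ⟨fun j => ℓ j - 1, funext fun j => (Nat.sub_add_cancel (hℓ j)).symm⟩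
  have hbound := WalshDecay.sum_walshCoeff_sq_le hf hderiv hcont hvar n
  have hsum : Summable (fun k : WalshDecay.bitClass (α + 1) (fun j => n j + 1) =>
      |WalshDecay.walshCoeff f k| ^ 2) := summable_of_sum_le (fun k => sq_nonneg _) hbound
  refine ⟨hsum, ?_⟩
  rw [Real.sqrt_le_left (mul_nonneg ENNReal.toReal_nonneg (by positivity))]
  exact hsum.tsum_le_of_sum_le hbound
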